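/- **Conventions.** A *topological graph* $E=(E^0,E^1,r,s)$ consists of second countable locally compact Hausdorff spaces $E^0$, $E^1$, a continuous map $r\colon E^1\to E^0$ and a local homeomorphism $s\colon E^1\to E^0$. For a continuous map $\psi\colon X\to Y$ of locally compact Hausdorff spaces, let $Y_{\psi\text{-src}}=Y\setminus\overline{\psi(X)}$, let $Y_{\psi\text{-fin}}$ be the set of $y\in Y$ having a precompact open neighbourhood $U$ with $\psi^{-1}(\overline U)$ compact, and let $Y_{\psi\text{-sing}}=Y\setminus\bigl(Y_{\psi\text{-fin}}\setminus\overline{Y_{\psi\text{-src}}}\bigr)$; write $E^0_{\text{sing}}=E^0_{r\text{-sing}}$. An *in-split* of $E$ is a triple $I=(\alpha,E^0_I,\psi)$ of a locally compact Hausdorff space $E_I^0$, a continuous map $\psi\colon E^1\to E^0_I$ and a continuous proper surjection $\alpha\colon E^0_I\to E^0$ which restricts to a homeomorphism from $E^0_{I,\psi\text{-sing}}$ onto $E^0_{\text{sing}}$, such that $\alpha\circ\psi=r$. The *in-split graph* $E_I$ has vertex space $E^0_I$, edge space $E^1_I=\{(e,v)\in E^1\times E^0_I: s(e)=\alpha(v)\}$,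 $r_I(e,v)=\psi(e)$ and $s_I(e,v)=v$. The *graph correspondence* $(\phi,X(E))$ is the $C_0(E^0)$-correspondence obtained by completing $C_c(E^1)$ with $$(x\cdot a)(e)=x(e)a(s(e)),\qquad (\phi(a)x)(e)=a(r(e))x(e),\qquad (x\mid y)(v)=\sum_{s(e)=v}\overline{x(e)}\,y(e);$$ the correspondence $(\phi_I,X(E_I))$ over $C_0(E_I^0)$ is defined by the same formulas. For a right Hilbert $A$-module $X$ and a $*$-homomorphism $\psi\colon B\to \mathrm{End}_A(X)$ into the adjointable operators, put $J_\psi=\psi^{-1}(\mathrm{End}^0_A(X))\cap\ker(\psi)^\perp$, where $\mathrm{End}^0_A(X)$ denotes the generalised compact operators and $\ker(\psi)^\perp=\{b\in B: b\ker(\psi)=0\}$. An *in-split* of a nondegenerate correspondence $(\phi,X)$ over $A$ is a triple $(\alpha,B,\psi)$ of a $C^*$-algebra $B$, a nondegenerate injective $*$-homomorphism $\alpha\colon A\to B$ and a $*$-homomorphism $\psi\colon B\to\mathrm{End}_A(X)$ such that $\psi\circ\alpha=\phi$, $\alpha(J_\phi)\subseteq J_\psi$, and the induced map $A/J_\phi\to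 B/J_\psi$ is an isomorphism. The associated *in-split correspondence* over $B$ is the interior tensor product $X\otimes_\alpha B$ with left action $(\psi\otimes\mathrm{Id})(b')(x\otimes b)=\psi(b')x\otimes b$. **Proposition.** Let $E$ be a topological graph and let $I=(\alpha,E^0_I,\psi)$ be an in-split of $E$. Then there are $*$-homomorphisms $\alpha^*\colon C_0(E^0)\to C_0(E^0_I)$ and $\psi^*\colon C_0(E^0_I)\to \mathrm{End}_{C_0(E^0)}(X(E))$ satisfying $$\alpha^*(f)=f\circ\alpha\quad(f\in C_0(E^0)),\qquad (\psi^*(f)x)(e)=f(\psi(e))\,x(e)\quad (f\in C_0(E^0_I),\ x\in C_c(E^1),\ e\in E^1),$$ such that $(\alpha^*,C_0(E^0_I),\psi^*)$ is an in-split of the (nondegenerate) graph correspondence $(\phi,X(E))$. Moreover, the in-split correspondence $(\psi^*\otimes\mathrm{Id},\,X(E)\otimes_{\alpha^*}C_0(E^0_I))$ is isomorphic to $(\phi_I,X(E_I))$ as a correspondence over $C_0(E^0_I)$: there is a linear bijection $\beta\colon X(E)\otimes_{\alpha^*}C_0(E^0_I)\to X(E_I)$ which preserves the $C_0(E_I^0)$-valued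 inner products and intertwines the left and the right actions of $C_0(E^0_I)$. -/

import Mathlib

open scoped ZeroAtInfty CompactlySupported TensorProduct ComplexConjugate

/-- A right `A`-module `V` with an `A`-valued semi-inner product `(x ∣ y)_A`, which is conjugate
linear in `x`, linear in `y` and satisfies `(x ∣ y · a)_A = (x ∣ y)_A a`; `act x a` is `x · a`.
Positive elements of `A` are those of the form `a* a`. It is not required that `(x ∣ x)_A = 0`
implies `x = 0`. (Mathlib's `CStarModule` has `(x ∣ a • y) = a (x ∣ y)`, the convention for left
modules, and is always definite, so it does not cover right modules over noncommutative algebras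
or their pre-completions.) -/
structure PreHilbertModule (A V : Type*) [NonUnitalCStarAlgebra A] [AddCommGroup V]
    [Module ℂ V] where
  act : V →ₗ[ℂ] A →ₗ[ℂ] V
  act_mul : ∀ x a b, act x (a * b) = act (act x a) b
  ip : V →ₗ⋆[ℂ] V →ₗ[ℂ] A
  ip_act : ∀ x y a, ip x (act y a) = ip x y * a
  star_ip : ∀ x y, star (ip x y) = ip y x
  ip_self : ∀ x, ∃ a, ip x x = star a * a

namespace PreHilbertModule

variable {A V : Type*} [NonUnitalCStarAlgebra A] [AddCommGroup V] [Module ℂ V]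
  (P : PreHilbertModule A V)

theorem act_ip (x y : V) (a : A) : P.ip (P.act x a) y = star a * P.ip x y := by
  rw [← P.star_ip, P.ip_act, star_mul, P.star_ip]

theorem norm_ip_sq_le (x y : V) : ‖P.ip x y‖ ^ 2 ≤ ‖P.ip x x‖ * ‖P.ip y y‖ := by
  let _ := CStarAlgebra.spectralOrder A
  have := CStarAlgebra.spectralOrderedRing A
  have key : ∀ t : ℝ, ‖P.ip x x‖ < t → ‖P.ip x y‖ ^ 2 ≤ t * ‖P.ip y y‖ := by
    intro t ht
    have ht0 : 0 < t := (norm_nonneg _).trans_lt ht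
    set a := P.ip x y with ha
    have hpos : 0 ≤ P.ip (P.act x a - (t : ℂ) • y) (P.act x a - (t : ℂ) • y) := by
      obtain ⟨b, hb⟩ := P.ip_self (P.act x a - (t : ℂ) • y)
      rw [hb]; exact star_mul_self_nonneg b
    have hexp : P.ip (P.act x a - (t : ℂ) • y) (P.act x a - (t : ℂ) • y)
        = star a * P.ip x x * a - t • (star a * a) - t • (star a * a)
          + t • t • P.ip y y := by
      have h1 : P.ip y x = star a := by rw [ha, P.star_ip]
      simp only [map_sub, LinearMap.sub_apply, LinearMap.map_smulₛₗ, LinearMap.smul_apply,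
        P.act_ip, P.ip_act, ← ha, h1, map_smul, Complex.conj_ofReal, mul_assoc]
      simp only [Complex.coe_smul, smul_sub, sub_sub, sub_add]
      abel_nf
    have h1 : star a * P.ip x x * a ≤ t • (star a * a) := by
      refine (CStarAlgebra.star_left_conjugate_le_norm_smul (hb := P.star_ip x x)).trans ?_
      exact smul_le_smul_of_nonneg_right ht.le (star_mul_self_nonneg a)
    rw [hexp] at hpos
    have h2 : t • (star a * a) ≤ t • t • P.ip y y := by
      have := add_le_add hpos h1
      rw [zero_add] at this
      have h3 := sub_nonneg.2 this
      have h4 : (0 : A) ≤ t • t • P.ip y y - t • (star a * a) := by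
        have h5 := add_nonneg hpos (sub_nonneg.2 h1)
        convert h5 using 1
        abel
      exact sub_nonneg.1 h4
    have h3 : star a * a ≤ t • P.ip y y := (smul_le_smul_iff_of_pos_left ht0).1 h2
    have h4 := CStarAlgebra.norm_le_norm_of_nonneg_of_le (star_mul_self_nonneg a) h3
    rw [CStarRing.norm_star_mul_self, norm_smul, Real.norm_of_nonneg ht0.le] at h4
    nlinarith
  refine le_of_forall_pos_le_add fun ε hε => ?_
  have h := key (‖P.ip x x‖ + ε / (‖P.ip y y‖ + 1)) (by
    have : 0 < ε / (‖P.ip y y‖ + 1) := by positivity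
    linarith)
  refine h.trans ?_
  have h2 : ε / (‖P.ip y y‖ + 1) * ‖P.ip y y‖ ≤ ε := by
    rw [div_mul_eq_mul_div, div_le_iff₀ (by positivity)]
    nlinarith [norm_nonneg (P.ip y y)]
  nlinarith

theorem sqrt_norm_smul (c : ℂ) (x : V) :
    √‖P.ip (c • x) (c • x)‖ = ‖c‖ * √‖P.ip x x‖ := by
  rw [LinearMap.map_smulₛₗ₂, map_smul, norm_smul, norm_smul, ← mul_assoc,
    Real.sqrt_mul (by positivity), RCLike.norm_conj, Real.sqrt_mul_self (norm_nonneg _)]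

theorem norm_ip_le_sqrt (x y : V) : ‖P.ip x y‖ ≤ √‖P.ip x x‖ * √‖P.ip y y‖ := by
  rw [← Real.sqrt_mul (norm_nonneg _)]
  exact Real.le_sqrt_of_sq_le (P.norm_ip_sq_le x y)

theorem sqrt_norm_add (x y : V) :
    √‖P.ip (x + y) (x + y)‖ ≤ √‖P.ip x x‖ + √‖P.ip y y‖ := by
  refine Real.sqrt_le_iff.2 ⟨add_nonneg (Real.sqrt_nonneg _) (Real.sqrt_nonneg _), ?_⟩
  have h := P.norm_ip_le_sqrt x y
  have h' := P.norm_ip_le_sqrt y x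
  have hx := Real.sq_sqrt (norm_nonneg (P.ip x x))
  have hy := Real.sq_sqrt (norm_nonneg (P.ip y y))
  calc ‖P.ip (x + y) (x + y)‖
      = ‖P.ip x x + P.ip x y + (P.ip y x + P.ip y y)‖ := by
        simp only [map_add, LinearMap.add_apply]
        congr 1; abel
    _ ≤ (‖P.ip x x‖ + ‖P.ip x y‖) + (‖P.ip y x‖ + ‖P.ip y y‖) :=
        (norm_add_le _ _).trans (add_le_add (norm_add_le _ _) (norm_add_le _ _))
    _ ≤ (√‖P.ip x x‖ + √‖P.ip y y‖) ^ 2 := by nlinarith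

/-- The space `V`, seminormed by `‖x‖ = ‖(x ∣ x)‖^{1/2}`. -/
def Pre (_ : PreHilbertModule A V) : Type _ := V

instance : AddCommGroup P.Pre := inferInstanceAs (AddCommGroup V)
instance : Module ℂ P.Pre := inferInstanceAs (Module ℂ V)

/-- The identity map `V → P.Pre`. -/
def toPre : V ≃ₗ[ℂ] P.Pre := LinearEquiv.refl ℂ V

noncomputable instance : Norm P.Pre := ⟨fun x => √‖P.ip (P.toPre.symm x) (P.toPre.symm x)‖⟩

theorem seminormedCore : SeminormedSpace.Core ℂ P.Pre where
  norm_nonneg _ := Real.sqrt_nonneg _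
  norm_smul c x := P.sqrt_norm_smul c (P.toPre.symm x)
  norm_triangle x y := P.sqrt_norm_add (P.toPre.symm x) (P.toPre.symm y)

noncomputable instance : SeminormedAddCommGroup P.Pre := .ofCore P.seminormedCore
noncomputable instance : NormedSpace ℂ P.Pre where
  norm_smul_le c x := (P.seminormedCore.norm_smul c x).le

/-- The Hausdorff completion of `V` for the seminorm `‖x‖ = ‖(x ∣ x)‖^{1/2}`: null vectors are
identified with `0`. -/
def Completion : Type _ := UniformSpace.Completion P.Pre

noncomputable instance : NormedAddCommGroup P.Completion :=
  inferInstanceAs (NormedAddCommGroup (UniformSpace.Completion P.Pre))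
noncomputable instance : NormedSpace ℂ P.Completion :=
  inferInstanceAs (NormedSpace ℂ (UniformSpace.Completion P.Pre))
instance : CompleteSpace P.Completion :=
  inferInstanceAs (CompleteSpace (UniformSpace.Completion P.Pre))

/-- The canonical map of `V` into its completion. -/
noncomputable def ι : V →ₗ[ℂ] P.Completion :=
  (UniformSpace.Completion.toComplL (𝕜 := ℂ) (E := P.Pre)).toLinearMap ∘ₗ P.toPre.toLinearMap

theorem norm_ι (x : V) : ‖P.ι x‖ = √‖P.ip x x‖ :=
  UniformSpace.Completion.norm_coe (P.toPre x)

theorem norm_ι_sq (x : V) : ‖P.ι x‖ ^ 2 = ‖P.ip x x‖ := by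
  rw [norm_ι, Real.sq_sqrt (norm_nonneg _)]

theorem denseRange_ι : DenseRange P.ι :=
  UniformSpace.Completion.denseRange_coe (α := P.Pre)

theorem norm_ip_le (x y : V) : ‖P.ip x y‖ ≤ ‖P.ι x‖ * ‖P.ι y‖ := by
  rw [norm_ι, norm_ι]; exact P.norm_ip_le_sqrt x y

theorem norm_act_le (x : V) (a : A) : ‖P.ι (P.act x a)‖ ≤ ‖a‖ * ‖P.ι x‖ := by
  refine le_of_sq_le_sq ?_ (by positivity)
  rw [mul_pow, norm_ι_sq, norm_ι_sq, P.ip_act, P.act_ip]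
  calc ‖star a * P.ip x x * a‖ ≤ ‖star a‖ * ‖P.ip x x‖ * ‖a‖ :=
        (norm_mul_le _ _).trans (by gcongr; exact norm_mul_le _ _)
    _ = ‖a‖ ^ 2 * ‖P.ip x x‖ := by rw [norm_star]; ring

theorem induction_ι {p : P.Completion → Prop} (hp : IsClosed {x | p x}) (h : ∀ x, p (P.ι x))
    (x : P.Completion) : p x :=
  P.denseRange_ι.induction_on x hp h

/-- For fixed `x : V`, the extension of `y ↦ (x ∣ y)` to the completion. -/
noncomputable def ipRight (x : V) : P.Completion →L[ℂ] A := (P.ip x).extendOfNorm P.ι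

theorem ipRight_ι (x y : V) : P.ipRight x (P.ι y) = P.ip x y :=
  LinearMap.extendOfNorm_eq P.denseRange_ι ⟨_, P.norm_ip_le x⟩ y

/-- `ipRight` as a conjugate linear map. -/
noncomputable def ipRightₗ : V →ₗ⋆[ℂ] P.Completion →L[ℂ] A where
  toFun := P.ipRight
  map_add' x y := by
    ext z
    induction z using P.induction_ι with
    | hp => exact isClosed_eq (by fun_prop) (by fun_prop)
    | h z => simp [ipRight_ι]
  map_smul' c x := by
    ext z
    induction z using P.induction_ι with
    | hp => exact isClosed_eq (by fun_prop) (by fun_prop)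
    | h z => simp [ipRight_ι]

theorem norm_ipRightₗ_le (x : V) : ‖P.ipRightₗ x‖ ≤ 1 * ‖P.ι x‖ := by
  rw [one_mul]
  exact LinearMap.opNorm_extendOfNorm_le P.denseRange_ι (norm_nonneg _) (P.norm_ip_le x)

/-- The inner product of the completion. -/
noncomputable def ipCompletion : P.Completion →L⋆[ℂ] P.Completion →L[ℂ] A :=
  P.ipRightₗ.extendOfNorm P.ι

theorem ipCompletion_ι (x y : V) : P.ipCompletion (P.ι x) (P.ι y) = P.ip x y := by
  rw [ipCompletion, LinearMap.extendOfNorm_eq P.denseRange_ι ⟨_, P.norm_ipRightₗ_le⟩]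
  exact P.ipRight_ι x y

/-- Right multiplication by `a` on the completion. -/
noncomputable def actCompletion (a : A) : P.Completion →L[ℂ] P.Completion :=
  (P.ι ∘ₗ P.act.flip a).extendOfNorm P.ι

theorem actCompletion_ι (a : A) (x : V) : P.actCompletion a (P.ι x) = P.ι (P.act x a) :=
  LinearMap.extendOfNorm_eq P.denseRange_ι ⟨_, fun x => P.norm_act_le x a⟩ x

/-- The right action of `A` on the completion. -/
noncomputable def actCompletionₗ : P.Completion →ₗ[ℂ] A →ₗ[ℂ] P.Completion :=
  LinearMap.flip
    { toFun := fun a => (P.actCompletion a).toLinearMap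
      map_add' := fun a b => by
        ext x
        induction x using P.induction_ι with
        | hp =>
          exact isClosed_eq (P.actCompletion (a + b)).continuous
            ((P.actCompletion a).continuous.add (P.actCompletion b).continuous)
        | h x => simp [actCompletion_ι]
      map_smul' := fun c a => by
        ext x
        induction x using P.induction_ι with
        | hp =>
          exact isClosed_eq (P.actCompletion (c • a)).continuous
            ((P.actCompletion a).continuous.const_smul c)
        | h x => simp [actCompletion_ι] }

theorem actCompletionₗ_apply (x : P.Completion) (a : A) :
    P.actCompletionₗ x a = P.actCompletion a x := rfl

end PreHilbertModule

/-- A right Hilbert `A`-module: `X` is complete for the norm `‖x‖ = ‖(x ∣ x)_A‖^{1/2}` (so the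
inner product is definite). -/
class HilbertModule (A X : Type*) [NonUnitalCStarAlgebra A] [NormedAddCommGroup X]
    [NormedSpace ℂ X] where
  toPre : PreHilbertModule A X
  norm_sq : ∀ x, ‖x‖ ^ 2 = ‖toPre.ip x x‖
  complete : CompleteSpace X

namespace PreHilbertModule

variable {A V : Type*} [NonUnitalCStarAlgebra A] [AddCommGroup V] [Module ℂ V]
  (P : PreHilbertModule A V)

/-- The extension of the module structure and of the inner product to the completion. -/
noncomputable def completionPre : PreHilbertModule A P.Completion where
  act := P.actCompletionₗ
  act_mul x a b := by
    simp only [actCompletionₗ_apply]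
    induction x using P.induction_ι with
    | hp => exact isClosed_eq (by fun_prop) (by fun_prop)
    | h x => simp [actCompletion_ι, P.act_mul]
  ip := ContinuousLinearMap.coeLM ℂ ∘ₛₗ P.ipCompletion.toLinearMap
  ip_act x y a := by
    change P.ipCompletion x (P.actCompletion a y) = P.ipCompletion x y * a
    induction x using P.induction_ι with
    | hp => exact isClosed_eq (by fun_prop) (by fun_prop)
    | h x =>
      induction y using P.induction_ι with
      | hp => exact isClosed_eq (by fun_prop) (by fun_prop)
      | h y => simp [actCompletion_ι, ipCompletion_ι, P.ip_act]
  star_ip x y := by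
    change star (P.ipCompletion x y) = P.ipCompletion y x
    induction x using P.induction_ι with
    | hp => exact isClosed_eq (by fun_prop) (by fun_prop)
    | h x =>
      induction y using P.induction_ι with
      | hp => exact isClosed_eq (by fun_prop) (by fun_prop)
      | h y => simp [ipCompletion_ι, P.star_ip]
  ip_self x := by
    let _ := CStarAlgebra.spectralOrder A
    have := CStarAlgebra.spectralOrderedRing A
    change ∃ a, P.ipCompletion x x = star a * a
    rw [← CStarAlgebra.nonneg_iff_eq_star_mul_self]
    induction x using P.induction_ι with
    | hp => exact isClosed_le (by fun_prop) (by fun_prop)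
    | h x =>
      rw [ipCompletion_ι]
      obtain ⟨a, ha⟩ := P.ip_self x
      rw [ha]; exact star_mul_self_nonneg a

noncomputable instance instHilbertModule : HilbertModule A P.Completion where
  toPre := P.completionPre
  norm_sq x := by
    change ‖x‖ ^ 2 = ‖P.ipCompletion x x‖
    induction x using P.induction_ι with
    | hp => exact isClosed_eq (by fun_prop) (by fun_prop)
    | h x => rw [ipCompletion_ι, norm_ι_sq]
  complete := inferInstance

end PreHilbertModule

namespace HilbertModule

variable (A : Type*) {X : Type*} [NonUnitalCStarAlgebra A] [NormedAddCommGroup X]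
  [NormedSpace ℂ X] [HilbertModule A X]

/-- The inner product `(x ∣ y)_A` of a Hilbert module. -/
noncomputable abbrev ip (x y : X) : A := (toPre (A := A) (X := X)).ip x y

/-- The right action `x · a` on a Hilbert module. -/
noncomputable abbrev act {A : Type*} [NonUnitalCStarAlgebra A] [HilbertModule A X]
    (x : X) (a : A) : X :=
  (toPre (A := A) (X := X)).act x a

theorem ip_self_eq_zero {x : X} (h : ip A x x = 0) : x = 0 := by
  have : ‖x‖ ^ 2 = ‖ip A x x‖ := norm_sq (A := A) x
  rw [h, norm_zero] at this
  simpa using this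

theorem ext_ip {x y : X} (h : ∀ z, ip A z x = ip A z y) : x = y := by
  refine sub_eq_zero.1 (ip_self_eq_zero A ?_)
  rw [ip, map_sub, sub_eq_zero]
  exact h _

variable (X) in
/-- The `*`-algebra `End_A(X)` of adjointable operators, with the operator norm. (Adjointable maps
are automatically linear, `A`-linear and bounded.) The adjoint of `T` is `star T`. -/
def Adjointable : Subalgebra ℂ (X →L[ℂ] X) where
  carrier := {T | ∃ S : X →L[ℂ] X, ∀ x y, ip A (T x) y = ip A x (S y)}
  mul_mem' := by
    rintro T T' ⟨S, hS⟩ ⟨S', hS'⟩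
    exact ⟨S' * S, fun x y => by simp [hS, hS']⟩
  add_mem' := by
    rintro T T' ⟨S, hS⟩ ⟨S', hS'⟩
    refine ⟨S + S', fun x y => ?_⟩
    have h1 := hS x y
    have h2 := hS' x y
    simp only [ip] at h1 h2 ⊢
    simp [h1, h2]
  algebraMap_mem' c := by
    refine ⟨algebraMap ℂ _ (star c), fun x y => ?_⟩
    simp [Algebra.algebraMap_eq_smul_one, ip]

namespace Adjointable

variable {A}

/-- The adjoint, which is unique because the inner product is definite. -/
noncomputable instance : Star (Adjointable A X) where
  star T := ⟨T.2.choose, T.1, fun x y => by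
    have h := T.2.choose_spec y x
    have h2 := congrArg star h
    simp only [ip, PreHilbertModule.star_ip] at h2 ⊢
    exact h2.symm⟩

theorem ip_star (T : Adjointable A X) (x y : X) :
    ip A (T.1 x) y = ip A x ((star T).1 y) := T.2.choose_spec x y

theorem ext_adj {S T : Adjointable A X} (h : ∀ x y, ip A x (S.1 y) = ip A x (T.1 y)) : S = T :=
  Subtype.ext (ContinuousLinearMap.ext fun y => ext_ip A fun x => h x y)

theorem ip_star_left (T : Adjointable A X) (x y : X) :
    ip A ((star T).1 x) y = ip A x (T.1 y) := by
  have h := congrArg star (ip_star T y x)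
  simp only [ip, PreHilbertModule.star_ip] at h ⊢
  exact h.symm

noncomputable instance : StarRing (Adjointable A X) where
  star_involutive T := ext_adj fun x y => by rw [← ip_star, ip_star_left]
  star_mul S T := ext_adj fun x y => by
    rw [← ip_star]
    change ip A (S.1 (T.1 x)) y = ip A x ((star T).1 ((star S).1 y))
    rw [ip_star, ip_star]
  star_add S T := ext_adj fun x y => by
    rw [← ip_star]
    have h1 := ip_star S x y
    have h2 := ip_star T x y
    simp only [ip] at h1 h2 ⊢
    change PreHilbertModule.ip _ (S.1 x + T.1 x) y
      = PreHilbertModule.ip _ x ((star S).1 y + (star T).1 y)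
    simp [h1, h2]

/-- The generalised compact operators: the closed linear span of the rank-one operators
`z ↦ x · (y ∣ z)_A`. -/
noncomputable def compacts (A X : Type*) [NonUnitalCStarAlgebra A] [NormedAddCommGroup X]
    [NormedSpace ℂ X] [HilbertModule A X] : Submodule ℂ (Adjointable A X) :=
  (Submodule.span ℂ {T | ∃ x y : X, ∀ z, T.1 z = act x (ip A y z)}).topologicalClosure

end Adjointable

end HilbertModule

open HilbertModule

section Correspondences

variable {A B X Y : Type*} [NonUnitalCStarAlgebra A] [NonUnitalCStarAlgebra B]
  [NormedAddCommGroup X] [NormedSpace ℂ X] [HilbertModule A X]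
  [NormedAddCommGroup Y] [NormedSpace ℂ Y] [HilbertModule B Y]

/-- The left action `φ` is nondegenerate: `φ(B)X` spans a dense subspace of `X`. -/
def IsNondegenerateAction (φ : B →⋆ₙₐ[ℂ] Adjointable A X) : Prop :=
  (Submodule.span ℂ {y : X | ∃ b x, y = (φ b).1 x}).topologicalClosure = ⊤

/-- The `*`-homomorphism `α` is nondegenerate: `α(A)B` spans a dense subspace of `B`. -/
def IsNondegenerateHom (α : A →⋆ₙₐ[ℂ] B) : Prop :=
  (Submodule.span ℂ {y : B | ∃ a b, y = α a * b}).topologicalClosure = ⊤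

/-- The ideal `J_φ = φ⁻¹(End⁰_A(X)) ∩ ker(φ)^⊥` of a left action `φ`. -/
noncomputable def covarianceIdeal (φ : B →⋆ₙₐ[ℂ] Adjointable A X) : Submodule ℂ B where
  carrier := {b | φ b ∈ Adjointable.compacts A X ∧ ∀ c, φ c = 0 → b * c = 0}
  add_mem' := by
    rintro a b ⟨ha, ha'⟩ ⟨hb, hb'⟩
    refine ⟨by rw [map_add]; exact add_mem ha hb, fun c hc => ?_⟩
    rw [add_mul, ha' c hc, hb' c hc, add_zero]
  zero_mem' := ⟨by rw [map_zero]; exact zero_mem _, fun c _ => zero_mul c⟩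
  smul_mem' := by
    rintro t b ⟨hb, hb'⟩
    refine ⟨by rw [map_smul]; exact Submodule.smul_mem _ t hb, fun c hc => ?_⟩
    rw [smul_mul_assoc, hb' c hc, smul_zero]

/-- `(α, B, ψ)` is an in-split of the nondegenerate correspondence `(φ, X)` over `A`. Here an
`A`-correspondence is a Hilbert `A`-module `X` with a `*`-homomorphism `φ : A → End_A(X)`. -/
structure IsInSplit (φ : A →⋆ₙₐ[ℂ] Adjointable A X) (α : A →⋆ₙₐ[ℂ] B)
    (ψ : B →⋆ₙₐ[ℂ] Adjointable A X) : Prop where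
  nondegenerate : IsNondegenerateAction φ
  hom_nondegenerate : IsNondegenerateHom α
  hom_injective : Function.Injective α
  comp_eq : ψ.comp α = φ
  map_ideal : covarianceIdeal φ ≤ (covarianceIdeal ψ).comap (LinearMapClass.linearMap α)
  /-- The induced `*`-homomorphism `A/J_φ → B/J_ψ` is an isomorphism, i.e. bijective. -/
  quotient_bijective : Function.Bijective
    ((covarianceIdeal φ).mapQ (covarianceIdeal ψ) (LinearMapClass.linearMap α) map_ideal)

/-- The pair `(α, β)` is a morphism of correspondences `(φX, X) → (φY, Y)`. -/
structure IsCorrespondenceMorphism (φX : A →⋆ₙₐ[ℂ] Adjointable A X)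
    (φY : B →⋆ₙₐ[ℂ] Adjointable B Y) (α : A →⋆ₙₐ[ℂ] B) (β : X →ₗ[ℂ] Y) : Prop where
  map_ip : ∀ x y, ip B (β x) (β y) = α (ip A x y)
  map_act : ∀ x a, β (act x a) = act (β x) (α a)
  map_left : ∀ a x, β ((φX a).1 x) = (φY (α a)).1 (β x)

end Correspondences

/-- A left action of `C` by adjointable operators on a pre-Hilbert module. -/
structure PreHilbertModule.LeftAction {A V : Type*} (C : Type*) [NonUnitalCStarAlgebra A]
    [AddCommGroup V] [Module ℂ V] [NonUnitalCStarAlgebra C] (P : PreHilbertModule A V) where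
  toHom : C →ₙₐ[ℂ] Module.End ℂ V
  ip_left : ∀ c x y, P.ip (toHom c x) y = P.ip x (toHom (star c) y)

namespace PreHilbertModule.LeftAction

variable {A V C : Type*} [NonUnitalCStarAlgebra A]
    [AddCommGroup V] [Module ℂ V] [NonUnitalCStarAlgebra C] {P : PreHilbertModule A V}
    (π : P.LeftAction C)

theorem norm_le (c : C) (x : V) : ‖P.ι (π.toHom c x)‖ ≤ ‖c‖ * ‖P.ι x‖ := by
  let _ := CStarAlgebra.spectralOrder A
  have := CStarAlgebra.spectralOrderedRing A
  let _ := CStarAlgebra.spectralOrder (Unitization ℂ C)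
  have := CStarAlgebra.spectralOrderedRing (Unitization ℂ C)
  let σ : Unitization ℂ C →ₐ[ℂ] Module.End ℂ V := Unitization.lift π.toHom
  have hσ : ∀ d x y, P.ip (σ d x) y = P.ip x (σ (star d) y) := by
    intro d x y
    induction d using Unitization.ind with
    | inl_add_inr r e => simp [σ, π.ip_left, Algebra.algebraMap_eq_smul_one]
  have hle : star (c : Unitization ℂ C) * c ≤ algebraMap ℝ _ (‖(c : Unitization ℂ C)‖ ^ 2) :=
    CStarAlgebra.star_mul_le_algebraMap_norm_sq
  rw [← sub_nonneg, CStarAlgebra.nonneg_iff_eq_star_mul_self] at hle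
  obtain ⟨d, hd⟩ := hle
  have hc : σ (c : Unitization ℂ C) = π.toHom c := by simp [σ]
  have h1 : P.ip (π.toHom c x) (π.toHom c x) + P.ip (σ d x) (σ d x)
      = ((‖c‖ ^ 2 : ℝ) : ℂ) • P.ip x x := by
    rw [← hc, hσ, hσ, ← map_add, ← Module.End.mul_apply, ← Module.End.mul_apply,
      ← LinearMap.add_apply, ← map_mul, ← map_mul, ← map_add, ← hd, add_sub_cancel,
      Unitization.norm_inr, IsScalarTower.algebraMap_apply ℝ ℂ (Unitization ℂ C),
      AlgHom.commutes, Algebra.algebraMap_eq_smul_one]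
    simp
  have h2 : P.ip (π.toHom c x) (π.toHom c x) ≤ ((‖c‖ ^ 2 : ℝ) : ℂ) • P.ip x x := by
    rw [← h1, le_add_iff_nonneg_right]
    obtain ⟨a, ha⟩ := P.ip_self (σ d x)
    rw [ha]; exact star_mul_self_nonneg a
  have h0 : 0 ≤ P.ip (π.toHom c x) (π.toHom c x) := by
    obtain ⟨a, ha⟩ := P.ip_self (π.toHom c x)
    rw [ha]; exact star_mul_self_nonneg a
  have h3 := CStarAlgebra.norm_le_norm_of_nonneg_of_le h0 h2
  rw [norm_smul, ← norm_ι_sq, ← norm_ι_sq, Complex.norm_real,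
    Real.norm_of_nonneg (by positivity), ← mul_pow] at h3
  exact le_of_sq_le_sq h3 (by positivity)

/-- The operator of `c` on the completion. -/
noncomputable def extendCLM (c : C) : P.Completion →L[ℂ] P.Completion :=
  (P.ι ∘ₗ π.toHom c).extendOfNorm P.ι

theorem extendCLM_ι (c : C) (x : V) : π.extendCLM c (P.ι x) = P.ι (π.toHom c x) :=
  LinearMap.extendOfNorm_eq P.denseRange_ι ⟨_, π.norm_le c⟩ x

theorem ip_extendCLM (c : C) (x y : P.Completion) :
    HilbertModule.ip A (π.extendCLM c x) y = HilbertModule.ip A x (π.extendCLM (star c) y) := by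
  change P.ipCompletion (π.extendCLM c x) y = P.ipCompletion x (π.extendCLM (star c) y)
  induction x using P.induction_ι with
  | hp => exact isClosed_eq (by fun_prop) (by fun_prop)
  | h x =>
    induction y using P.induction_ι with
    | hp => exact isClosed_eq (by fun_prop) (by fun_prop)
    | h y => rw [extendCLM_ι, extendCLM_ι, ipCompletion_ι, ipCompletion_ι, π.ip_left]

/-- The extension of a left action to the completion, as a `*`-homomorphism
into the adjointable operators. -/
noncomputable def extend : C →⋆ₙₐ[ℂ] Adjointable A P.Completion where
  toFun c := ⟨π.extendCLM c, π.extendCLM (star c), π.ip_extendCLM c⟩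
  map_smul' t c := Subtype.ext <| ContinuousLinearMap.ext fun x => by
    induction x using P.induction_ι with
    | hp => exact isClosed_eq (by fun_prop) (by fun_prop)
    | h x => simp [extendCLM_ι]
  map_zero' := Subtype.ext <| ContinuousLinearMap.ext fun x => by
    induction x using P.induction_ι with
    | hp => exact isClosed_eq (by fun_prop) (by fun_prop)
    | h x => simp [extendCLM_ι]
  map_add' c d := Subtype.ext <| ContinuousLinearMap.ext fun x => by
    induction x using P.induction_ι with
    | hp => exact isClosed_eq (by fun_prop) (by fun_prop)
    | h x => simp [extendCLM_ι]
  map_mul' c d := Subtype.ext <| ContinuousLinearMap.ext fun x => by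
    induction x using P.induction_ι with
    | hp => exact isClosed_eq (by fun_prop) (by fun_prop)
    | h x => simp [extendCLM_ι]
  map_star' c := Adjointable.ext_adj fun x y => by
    rw [← Adjointable.ip_star]
    exact (π.ip_extendCLM c x y).symm

theorem extend_ι (c : C) (x : V) : (π.extend c).1 (P.ι x) = P.ι (π.toHom c x) :=
  π.extendCLM_ι c x

end PreHilbertModule.LeftAction

namespace HilbertModule

section Positivity

variable {A X : Type*} [NonUnitalCStarAlgebra A] [NormedAddCommGroup X]
  [NormedSpace ℂ X] [HilbertModule A X]

theorem exists_pos_sub_pos {D : Type*} [NonUnitalCStarAlgebra D] (T : D) (hT : IsSelfAdjoint T) :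
    ∃ p m : D, T = star p * p - star m * m ∧ star m * m * (star p * p) = 0 := by
  let _ := CStarAlgebra.spectralOrder D
  have := CStarAlgebra.spectralOrderedRing D
  obtain ⟨p, hp⟩ := CStarAlgebra.nonneg_iff_eq_star_mul_self.1 (CFC.posPart_nonneg T)
  obtain ⟨m, hm⟩ := CStarAlgebra.nonneg_iff_eq_star_mul_self.1 (CFC.negPart_nonneg T)
  refine ⟨p, m, ?_, ?_⟩
  · rw [← hp, ← hm, CFC.posPart_sub_negPart T hT]
  · rw [← hp, ← hm, CFC.negPart_mul_posPart]

/-- The Gram matrix of finitely many vectors is of the form `M* M`. -/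
theorem exists_gram_eq {n : Type*} [Fintype n] (x : n → X) :
    ∃ M : n → n → A, ∀ i j, ip A (x i) (x j) = ∑ k, star (M k i) * M k j := by
  classical
  let _ := CStarAlgebra.spectralOrder A
  have := CStarAlgebra.spectralOrderedRing A
  let T : CStarMatrix n n A := CStarMatrix.ofMatrix (Matrix.of fun i j => ip A (x i) (x j))
  have hT : IsSelfAdjoint T := by
    ext i j
    simp [T, CStarMatrix.star_apply, ip, PreHilbertModule.star_ip]
  obtain ⟨p, m, hTN, hmp⟩ := exists_pos_sub_pos T hT
  set N : CStarMatrix n n A := star m * m with hm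
  have hNs : star N = N := by rw [hm, star_mul, star_star]
  have h1 : N * T * N = - (star (m * N) * (m * N)) := by
    have : star (m * N) * (m * N) = N * N * N := by
      rw [star_mul, hNs]
      simp only [hm, mul_assoc]
    rw [this, hTN, mul_sub, hmp, zero_sub, neg_mul]
  have h2 : ∀ k, (N * T * N) k k
      = ip A (∑ i, act (x i) (N i k)) (∑ i, act (x i) (N i k)) := by
    intro k
    have hs : ∀ i, N k i = star (N i k) := fun i => by
      conv_lhs => rw [← hNs]
      rfl
    simp only [CStarMatrix.mul_apply, ip, act, map_sum, LinearMap.sum_apply,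
      PreHilbertModule.ip_act, PreHilbertModule.act_ip, Finset.sum_mul, hs]
    rfl
  have h3 : m * N = 0 := by
    ext i k
    have h4 : (N * T * N) k k = - ∑ i, star ((m * N) i k) * (m * N) i k := by
      rw [h1]
      simp [CStarMatrix.mul_apply, CStarMatrix.star_apply]
    have h5 : 0 ≤ (N * T * N) k k := by
      rw [h2]
      obtain ⟨a, ha⟩ := (toPre (A := A) (X := X)).ip_self (∑ i, act (x i) (N i k))
      rw [ip, ha]; exact star_mul_self_nonneg a
    rw [h4] at h5
    have h6 : ∀ i ∈ Finset.univ, 0 ≤ star ((m * N) i k) * (m * N) i k :=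
      fun i _ => star_mul_self_nonneg _
    have h7 := (Finset.sum_eq_zero_iff_of_nonneg h6).1
      (le_antisymm (neg_nonneg.1 h5) (Finset.sum_nonneg h6)) i (Finset.mem_univ i)
    simpa using h7
  have h8 : N = 0 := by
    have h9 : N * N = 0 := by rw [hm, mul_assoc, ← hm, h3, mul_zero]
    have : star N * N = 0 := by rw [hNs, h9]
    simpa using this
  have hT0 : T = star p * p := by rw [hTN, h8, sub_zero]
  refine ⟨fun i j => p i j, fun i j => ?_⟩
  have := congrFun (congrFun hT0 i) j
  simpa [T, CStarMatrix.mul_apply, CStarMatrix.star_apply] using this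

end Positivity

section Tensor

variable {A B : Type*} (X : Type*) [NonUnitalCStarAlgebra A] [NonUnitalCStarAlgebra B]
  [NormedAddCommGroup X] [NormedSpace ℂ X] [HilbertModule A X] (α : A →⋆ₙₐ[ℂ] B)

/-- The linear map `x' ⊗ b' ↦ b* α((x ∣ x')_A) b'`. -/
noncomputable def tensorIpRight (x : X) (b : B) : X ⊗[ℂ] B →ₗ[ℂ] B :=
  TensorProduct.lift <| LinearMap.mk₂ ℂ (fun x' b' => star b * α (ip A x x') * b')
    (fun x y c => by simp [ip, mul_add, add_mul])
    (fun t x c => by simp [ip, mul_smul_comm, smul_mul_assoc])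
    (fun x c d => by simp [mul_add])
    (fun t x c => by simp [mul_smul_comm])

/-- The sesquilinear form `(x ⊗ b ∣ x' ⊗ b') = b* α((x ∣ x')_A) b'`. -/
noncomputable def tensorIp : X ⊗[ℂ] B →ₗ⋆[ℂ] X ⊗[ℂ] B →ₗ[ℂ] B :=
  TensorProduct.lift <| LinearMap.mk₂'ₛₗ (starRingEnd ℂ) (starRingEnd ℂ) (tensorIpRight X α)
    (fun x y c => by ext; simp [tensorIpRight, ip, mul_add, add_mul])
    (fun t x c => by ext; simp [tensorIpRight, ip, mul_smul_comm, smul_mul_assoc])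
    (fun x c d => by ext; simp [tensorIpRight, add_mul])
    (fun t x c => by ext; simp [tensorIpRight, smul_mul_assoc])

theorem tensorIp_tmul (x x' : X) (b b' : B) :
    tensorIp X α (x ⊗ₜ b) (x' ⊗ₜ b') = star b * α (ip A x x') * b' := by
  simp [tensorIp, tensorIpRight]

/-- The algebraic tensor product `X ⊗ B` with `(x ⊗ b) · c = x ⊗ bc` and
`(x ⊗ b ∣ x' ⊗ b') = b* α((x ∣ x')_A) b'`. -/
noncomputable def tensorPre : PreHilbertModule B (X ⊗[ℂ] B) where
  act := ((LinearMap.lTensorHom X).comp (LinearMap.mul ℂ B).flip).flip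
  act_mul z a b := by
    induction z with
    | zero => simp
    | tmul x c => simp [mul_assoc]
    | add z w hz hw => simp only [map_add, LinearMap.add_apply, hz, hw]
  ip := tensorIp X α
  ip_act z w a := by
    induction z with
    | zero => simp
    | tmul x c =>
      induction w with
      | zero => simp
      | tmul y d => simp [tensorIp_tmul, mul_assoc]
      | add z w hz hw => simp only [map_add, LinearMap.add_apply, hz, hw, add_mul]
    | add z w hz hw => simp only [map_add, LinearMap.add_apply, hz, hw, add_mul]
  star_ip z w := by
    induction z with
    | zero => simp
    | tmul x c =>
      induction w with
      | zero => simp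
      | tmul y d => simp [tensorIp_tmul, mul_assoc, ← map_star, ip, PreHilbertModule.star_ip]
      | add z w hz hw => simp only [map_add, LinearMap.add_apply, star_add, hz, hw]
    | add z w hz hw => simp only [map_add, LinearMap.add_apply, star_add, hz, hw]
  ip_self z := by
    let _ := CStarAlgebra.spectralOrder B
    have := CStarAlgebra.spectralOrderedRing B
    obtain ⟨S, rfl⟩ := TensorProduct.exists_finset z
    obtain ⟨M, hM⟩ := exists_gram_eq (A := A) (fun i : S => i.1.1)
    rw [← CStarAlgebra.nonneg_iff_eq_star_mul_self, ← Finset.sum_coe_sort]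
    have : tensorIp X α (∑ i : S, i.1.1 ⊗ₜ[ℂ] i.1.2) (∑ i : S, i.1.1 ⊗ₜ[ℂ] i.1.2)
        = ∑ k : S, star (∑ i : S, α (M k i) * i.1.2) * (∑ i : S, α (M k i) * i.1.2) := by
      simp only [map_sum, LinearMap.sum_apply, tensorIp_tmul, hM, star_sum, star_mul,
        Finset.sum_mul, Finset.mul_sum, map_mul, map_star, mul_assoc]
      exact (Finset.sum_congr rfl fun j _ => Finset.sum_comm).trans Finset.sum_comm
    rw [this]
    exact Finset.sum_nonneg fun k _ => star_mul_self_nonneg _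

/-- The interior tensor product `X ⊗_α B`, a Hilbert `B`-module. -/
abbrev Tensor : Type _ := (tensorPre X α).Completion

/-- The elementary tensor `x ⊗ b` in `X ⊗_α B`. -/
noncomputable def tmul {X : Type*} [NormedAddCommGroup X] [NormedSpace ℂ X] [HilbertModule A X]
    (α : A →⋆ₙₐ[ℂ] B) (x : X) (b : B) : Tensor X α := (tensorPre X α).ι (x ⊗ₜ b)

variable {C : Type*} [NonUnitalCStarAlgebra C] {X}

/-- The left action `c (x ⊗ b) = ψ(c) x ⊗ b` on the algebraic tensor product. -/
noncomputable def tensorLeftAction (ψ : C →⋆ₙₐ[ℂ] Adjointable A X) :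
    (tensorPre X α).LeftAction C where
  toHom :=
    { toFun := fun c => LinearMap.rTensor B (ψ c).1.toLinearMap
      map_smul' := fun t c => by ext; simp [TensorProduct.smul_tmul']
      map_zero' := by ext; simp
      map_add' := fun c d => by ext; simp
      map_mul' := fun c d => by ext; simp }
  ip_left c z w := by
    change tensorIp X α _ _ = tensorIp X α _ _
    induction z with
    | zero => simp
    | tmul x b =>
      induction w with
      | zero => simp
      | tmul y d => simp [tensorIp_tmul, Adjointable.ip_star, map_star]
      | add z w hz hw => simp only [map_add, hz, hw]
    | add z w hz hw => simp only [map_add, LinearMap.add_apply, hz, hw]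

/-- The left action `ψ ⊗ Id` on `X ⊗_α B`. -/
noncomputable def tensorAction (ψ : C →⋆ₙₐ[ℂ] Adjointable A X) :
    C →⋆ₙₐ[ℂ] Adjointable B (Tensor X α) :=
  (tensorLeftAction α ψ).extend

theorem tensorAction_tmul (ψ : C →⋆ₙₐ[ℂ] Adjointable A X) (c : C) (x : X) (b : B) :
    (tensorAction α ψ c).1 (tmul α x b) = tmul α ((ψ c).1 x) b :=
  (tensorLeftAction α ψ).extend_ι c (x ⊗ₜ b)

end Tensor

end HilbertModule

section SingularSets

variable {X Y : Type*} [TopologicalSpace X] [TopologicalSpace Y]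

/-- The `ψ`-sources `Y ∖ closure ψ(X)`. -/
def sourceSet (ψ : X → Y) : Set Y := (closure (Set.range ψ))ᶜ

/-- The `ψ`-finite receivers: points with a precompact open neighbourhood `U` such that
`ψ⁻¹(closure U)` is compact. -/
def finiteReceiverSet (ψ : X → Y) : Set Y :=
  {y | ∃ U : Set Y, IsOpen U ∧ y ∈ U ∧ IsCompact (closure U) ∧ IsCompact (ψ ⁻¹' closure U)}

/-- The `ψ`-regular points. -/
def regularSet (ψ : X → Y) : Set Y := finiteReceiverSet ψ \ closure (sourceSet ψ)

/-- The `ψ`-singular points. -/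
def singularSet (ψ : X → Y) : Set Y := (regularSet ψ)ᶜ

end SingularSets

section FiberSum

open Topology Filter

variable {V E : Type*} [TopologicalSpace V] [TopologicalSpace E] {s : E → V}

theorem IsLocalHomeomorph.finite_fiber_inter (hs : IsLocalHomeomorph s) {K : Set E}
    (hK : IsCompact K) (v : V) : (s ⁻¹' {v} ∩ K).Finite := by
  have h : ∀ e : E, ∃ U ∈ 𝓝 e, Set.InjOn s U := fun e => by
    obtain ⟨U, hU, he, hi⟩ := hs.isLocallyInjective e
    exact ⟨U, hU.mem_nhds he, hi⟩
  choose U hU hinj using h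
  obtain ⟨t, -, ht⟩ := hK.elim_nhds_subcover U fun e _ => hU e
  refine Set.Finite.subset (t.finite_toSet.biUnion (t := fun e => s ⁻¹' {v} ∩ U e) fun e _ => ?_) ?_
  · refine Set.Subsingleton.finite fun a ha b hb => hinj e ha.2 hb.2 ?_
    rw [ha.1, hb.1]
  · rintro e ⟨he, heK⟩
    obtain ⟨i, hi, hie⟩ := Set.mem_iUnion₂.1 (ht heK)
    exact Set.mem_iUnion₂.2 ⟨i, hi, he, hie⟩

theorem continuous_fiberSum_of_injOn [T2Space V] (hs : IsLocalHomeomorph s) {f : E → ℂ}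
    (hf : Continuous f) (hc : HasCompactSupport f) {U : Set E} (hU : IsOpen U)
    (hi : Set.InjOn s U) (hfU : tsupport f ⊆ U) :
    Continuous fun v => ∑ᶠ e ∈ s ⁻¹' {v}, f e := by
  have hF : ∀ e ∈ U, ∑ᶠ e' ∈ s ⁻¹' {s e}, f e' = f e := by
    intro e he
    rw [← finsum_mem_singleton (f := f) (a := e)]
    refine finsum_mem_inter_support_eq _ _ _ (Set.ext fun e' => ?_)
    simp only [Set.mem_inter_iff, Set.mem_preimage, Set.mem_singleton_iff]
    refine and_congr_left fun h => ⟨fun h' => hi (hfU (subset_tsupport f h)) he h', ?_⟩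
    rintro rfl; rfl
  rw [continuous_iff_continuousAt]
  intro v
  by_cases hv : v ∈ s '' tsupport f
  · obtain ⟨e, he, rfl⟩ := hv
    rw [ContinuousAt, hF e (hfU he), ← hs.map_nhds_eq e, tendsto_map'_iff]
    refine (hf.tendsto e).congr' ?_
    filter_upwards [hU.mem_nhds (hfU he)] with e' he'
    exact (hF e' he').symm
  · have hcl : IsClosed (s '' tsupport f) := (hc.image hs.continuous).isClosed
    have h0 : ∀ w ∉ s '' tsupport f, ∑ᶠ e ∈ s ⁻¹' {w}, f e = 0 := by
      intro w hw
      refine finsum_mem_eq_zero_of_forall_eq_zero fun e he => ?_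
      by_contra hne
      exact hw ⟨e, subset_tsupport f hne, he⟩
    rw [ContinuousAt, h0 v hv]
    refine tendsto_const_nhds.congr' ?_
    filter_upwards [hcl.isOpen_compl.mem_nhds hv] with w hw
    exact (h0 w hw).symm

theorem continuous_fiberSum [T2Space V] [T2Space E] [LocallyCompactSpace E]
    (hs : IsLocalHomeomorph s) {f : E → ℂ} (hf : Continuous f) (hc : HasCompactSupport f) :
    Continuous fun v => ∑ᶠ e ∈ s ⁻¹' {v}, f e := by
  have h : ∀ e : E, ∃ U : Set E, IsOpen U ∧ e ∈ U ∧ Set.InjOn s U := hs.isLocallyInjective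
  choose U hU heU hinj using h
  obtain ⟨t, -, ht⟩ := hc.isCompact.elim_nhds_subcover U fun e _ => (hU e).mem_nhds (heU e)
  let g : Fin t.card → Set E := fun i => U (t.equivFin.symm i)
  have hcov : tsupport f ⊆ ⋃ i, g i := by
    intro e he
    obtain ⟨i, hi, hie⟩ := Set.mem_iUnion₂.1 (ht he)
    exact Set.mem_iUnion.2 ⟨t.equivFin ⟨i, hi⟩, by simpa [g] using hie⟩
  obtain ⟨ρ, hρs, hρ1, -, hρc⟩ :=
    exists_continuous_sum_one_of_isOpen_isCompact (fun i => hU _) hc.isCompact hcov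
  have hsum : ∀ e, f e = ∑ i, (ρ i e : ℂ) * f e := by
    intro e
    rw [← Finset.sum_mul]
    by_cases he : f e = 0
    · simp [he]
    · have h1 := hρ1 (subset_tsupport f he)
      simp only [Finset.sum_apply, Pi.one_apply] at h1
      rw [← Complex.ofReal_sum, h1, Complex.ofReal_one, one_mul]
  have hcont : ∀ i, Continuous fun v => ∑ᶠ e ∈ s ⁻¹' {v}, (ρ i e : ℂ) * f e := by
    intro i
    refine continuous_fiberSum_of_injOn hs (by fun_prop) hc.mul_left (hU _)
      (hinj (t.equivFin.symm i)) ((closure_mono ?_).trans (hρs i))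
    intro e he
    have := left_ne_zero_of_mul he
    simpa using this
  refine (continuous_finsetSum Finset.univ fun i _ => hcont i).congr fun v => ?_
  have hfin := hs.finite_fiber_inter hc.isCompact v
  have key : ∀ k : E → ℂ, (Function.support k ⊆ tsupport f) →
      ∑ᶠ e ∈ s ⁻¹' {v}, k e = ∑ e ∈ hfin.toFinset, k e := by
    intro k hk
    refine finsum_mem_eq_sum_of_inter_support_eq _ (Set.ext fun e => ?_)
    simp only [Set.Finite.coe_toFinset, Set.mem_inter_iff]
    exact ⟨fun h => ⟨⟨h.1, hk h.2⟩, h.2⟩, fun h => ⟨h.1.1, h.2⟩⟩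
  rw [key f (subset_tsupport f)]
  rw [Finset.sum_congr rfl fun i _ => key (fun e => (ρ i e : ℂ) * f e) fun e he =>
    subset_tsupport f (right_ne_zero_of_mul he), Finset.sum_comm]
  exact Finset.sum_congr rfl fun e _ => (hsum e).symm

end FiberSum

/-- A topological graph with vertex space `V` and edge space `E`: a continuous range map `r` and a
local homeomorphism `s`, the source map. The assumptions that `V` and `E` are second countable
locally compact Hausdorff spaces are made by type classes where they are used. -/
structure TopologicalGraph (V E : Type*) [TopologicalSpace V] [TopologicalSpace E] where
  r : C(E, V)
  s : E → V
  isLocalHomeomorph_s : IsLocalHomeomorph s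

namespace TopologicalGraph

/-- The function `e ↦ g(ψ(e)) x(e)`. -/
noncomputable def mulComp {E W : Type*} [TopologicalSpace E] [TopologicalSpace W]
    (ψ : C(E, W)) (g : C₀(W, ℂ)) (x : C_c(E, ℂ)) : C_c(E, ℂ) where
  toFun e := g (ψ e) * x e
  continuous_toFun := by fun_prop
  hasCompactSupport' := x.hasCompactSupport.mul_left

theorem mulComp_apply {E W : Type*} [TopologicalSpace E] [TopologicalSpace W]
    (ψ : C(E, W)) (g : C₀(W, ℂ)) (x : C_c(E, ℂ)) (e : E) :
    mulComp ψ g x e = g (ψ e) * x e := rfl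

theorem exists_finset {V E : Type*} [TopologicalSpace V] [TopologicalSpace E]
    (G : TopologicalGraph V E) {K : Set E} (hK : IsCompact K) (v : V) :
    ∃ t : Finset E, (∀ e ∈ t, G.s e = v) ∧ ∀ e, G.s e = v → e ∈ K → e ∈ t := by
  have := G.isLocalHomeomorph_s.finite_fiber_inter hK v
  exact ⟨this.toFinset, fun e he => ((this.mem_toFinset).1 he).1,
    fun e h1 h2 => this.mem_toFinset.2 ⟨h1, h2⟩⟩

section Correspondence

variable {V E W : Type*} [TopologicalSpace V] [TopologicalSpace E] [TopologicalSpace W]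
  [T2Space V] [T2Space E] [LocallyCompactSpace E] (G : TopologicalGraph V E)

/-- The function `v ↦ ∑_{s(e) = v} f(e)`, a finite sum for every `v`. -/
noncomputable def fiberSum (f : C_c(E, ℂ)) : C₀(V, ℂ) where
  toFun v := ∑ᶠ e ∈ G.s ⁻¹' {v}, f e
  continuous_toFun :=
    continuous_fiberSum G.isLocalHomeomorph_s f.continuous f.hasCompactSupport
  zero_at_infty' := by
    refine HasCompactSupport.is_zero_at_infty (HasCompactSupport.intro
      (f.hasCompactSupport.image G.isLocalHomeomorph_s.continuous) fun v hv => ?_)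
    refine finsum_mem_eq_zero_of_forall_eq_zero fun e he => ?_
    by_contra hne
    exact hv ⟨e, subset_tsupport f hne, he⟩

theorem fiberSum_apply (f : C_c(E, ℂ)) (v : V) :
    G.fiberSum f v = ∑ᶠ e ∈ G.s ⁻¹' {v}, f e := rfl

theorem fiberSum_eq_sum (f : C_c(E, ℂ)) (v : V) {t : Finset E} (ht : ∀ e ∈ t, G.s e = v)
    (h : ∀ e, G.s e = v → f e ≠ 0 → e ∈ t) : G.fiberSum f v = ∑ e ∈ t, f e := by
  refine finsum_mem_eq_sum_of_inter_support_eq _ (Set.ext fun e => ?_)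
  simp only [Set.mem_inter_iff, Function.mem_support, SetLike.mem_coe]
  exact ⟨fun h' => ⟨h e h'.1 h'.2, h'.2⟩, fun h' => ⟨ht e h'.1, h'.2⟩⟩

/-- For `x ∈ C_c(E)`, all inner products with `x` are sums over one finite set. -/
theorem exists_finset_fiberSum (x : C_c(E, ℂ)) (v : V) :
    ∃ t : Finset E, (∀ e ∈ t, G.s e = v) ∧ ∀ f : C_c(E, ℂ), (∀ e, x e = 0 → f e = 0) →
      G.fiberSum f v = ∑ e ∈ t, f e := by
  obtain ⟨t, ht, ht'⟩ := G.exists_finset x.hasCompactSupport.isCompact v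
  refine ⟨t, ht, fun f hf => G.fiberSum_eq_sum f v ht fun e he hne => ht' e he ?_⟩
  exact subset_tsupport x fun h => hne (hf e h)

theorem fiberSum_star_mul_self (x : C_c(E, ℂ)) (v : V) :
    ∃ r : ℝ, 0 ≤ r ∧ G.fiberSum (star x * x) v = r := by
  obtain ⟨t, -, ht⟩ := G.exists_finset_fiberSum x v
  refine ⟨∑ e ∈ t, Complex.normSq (x e), Finset.sum_nonneg fun e _ => Complex.normSq_nonneg _, ?_⟩
  rw [ht _ fun e he => by simp [he], Complex.ofReal_sum]
  exact Finset.sum_congr rfl fun e _ => by simp [Complex.normSq_eq_conj_mul_self]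

/-- `C_c(E)` with `(x · a)(e) = x(e) a(s(e))` and `(x ∣ y)(v) = ∑_{s(e) = v} conj(x(e)) y(e)`. -/
noncomputable def preModule : PreHilbertModule C₀(V, ℂ) C_c(E, ℂ) where
  act := LinearMap.mk₂ ℂ (fun x a => mulComp ⟨G.s, G.isLocalHomeomorph_s.continuous⟩ a x)
    (fun x y a => by ext e; simp [mulComp_apply, mul_add])
    (fun t x a => by ext e; simp [mulComp_apply, mul_left_comm])
    (fun x a b => by ext e; simp [mulComp_apply, add_mul])
    (fun t x a => by ext e; simp [mulComp_apply, mul_assoc])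
  act_mul x a b := by ext e; simp [mulComp_apply, mul_assoc, mul_left_comm]
  ip := LinearMap.mk₂'ₛₗ (starRingEnd ℂ) (RingHom.id ℂ) (fun x y => G.fiberSum (star x * y))
    (fun x y z => by
      ext v
      obtain ⟨t, -, ht⟩ := G.exists_finset_fiberSum z v
      rw [ZeroAtInftyContinuousMap.add_apply, ht _ fun e he => by simp [he],
        ht _ fun e he => by simp [he], ht _ fun e he => by simp [he]]
      simp [add_mul, Finset.sum_add_distrib])
    (fun c x z => by
      ext v
      obtain ⟨t, -, ht⟩ := G.exists_finset_fiberSum z v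
      rw [ZeroAtInftyContinuousMap.smul_apply, ht _ fun e he => by simp [he],
        ht _ fun e he => by simp [he]]
      simp [mul_assoc, Finset.mul_sum])
    (fun z x y => by
      ext v
      obtain ⟨t, -, ht⟩ := G.exists_finset_fiberSum z v
      rw [ZeroAtInftyContinuousMap.add_apply, ht _ fun e he => by simp [he],
        ht _ fun e he => by simp [he], ht _ fun e he => by simp [he]]
      simp [mul_add, Finset.sum_add_distrib])
    (fun c z x => by
      ext v
      obtain ⟨t, -, ht⟩ := G.exists_finset_fiberSum z v
      rw [ZeroAtInftyContinuousMap.smul_apply, ht _ fun e he => by simp [he],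
        ht _ fun e he => by simp [he]]
      simp [mul_left_comm, Finset.mul_sum])
  ip_act x y a := by
    ext v
    obtain ⟨t, hv, ht⟩ := G.exists_finset_fiberSum x v
    simp only [LinearMap.mk₂'ₛₗ_apply, LinearMap.mk₂_apply]
    rw [ZeroAtInftyContinuousMap.mul_apply, ht _ fun e he => by simp [he],
      ht _ fun e he => by simp [he], Finset.sum_mul]
    refine Finset.sum_congr rfl fun e he => ?_
    simp only [CompactlySupportedContinuousMap.mul_apply, mulComp_apply, ContinuousMap.coe_mk,
      hv e he]
    ring
  star_ip x y := by
    ext v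
    obtain ⟨t, hv, ht⟩ := G.exists_finset_fiberSum x v
    simp only [LinearMap.mk₂'ₛₗ_apply, ZeroAtInftyContinuousMap.star_apply]
    rw [ht _ fun e he => by simp [he], ht _ fun e he => by simp [he], star_sum]
    refine Finset.sum_congr rfl fun e he => ?_
    simp [mul_comm]
  ip_self x := by
    refine ⟨⟨⟨fun v => ((√(G.fiberSum (star x * x) v).re : ℝ) : ℂ), by fun_prop⟩, ?_⟩, ?_⟩
    · have h1 : Continuous fun z : ℂ => ((√z.re : ℝ) : ℂ) := by fun_prop
      have h2 := (h1.tendsto 0).comp (G.fiberSum (star x * x)).zero_at_infty'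
      simp only [Complex.zero_re, Real.sqrt_zero, Complex.ofReal_zero] at h2
      exact h2
    · ext v
      obtain ⟨r, hr, h⟩ := G.fiberSum_star_mul_self x v
      simp only [LinearMap.mk₂'ₛₗ_apply, ZeroAtInftyContinuousMap.mul_apply,
        ZeroAtInftyContinuousMap.star_apply, ZeroAtInftyContinuousMap.coe_mk]
      rw [h, Complex.ofReal_re, Complex.star_def, Complex.conj_ofReal, ← Complex.ofReal_mul,
        Real.mul_self_sqrt hr]

/-- The Hilbert `C₀(V)`-module `X(G)`, the completion of `C_c(E)`. -/
abbrev X : Type _ := G.preModule.Completion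

/-- The canonical map `C_c(E) → X(G)`. -/
noncomputable def toX : C_c(E, ℂ) →ₗ[ℂ] G.X := G.preModule.ι

/-- Multiplication by `g ∘ ψ` on `C_c(E)`, as a left action of `C₀(W)`. -/
noncomputable def preAction (ψ : C(E, W)) : G.preModule.LeftAction C₀(W, ℂ) where
  toHom :=
    { toFun := fun g =>
        { toFun := mulComp ψ g
          map_add' := fun x y => by ext e; simp [mulComp_apply, mul_add]
          map_smul' := fun t x => by ext e; simp [mulComp_apply, mul_left_comm] }
      map_smul' := fun t g => by ext x e; simp [mulComp_apply, mul_assoc]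
      map_zero' := by ext x e; simp [mulComp_apply]
      map_add' := fun g h => by ext x e; simp [mulComp_apply, add_mul]
      map_mul' := fun g h => by ext x e; simp [mulComp_apply, mul_assoc] }
  ip_left g x y := by
    ext v
    obtain ⟨t, hv, ht⟩ := G.exists_finset_fiberSum x v
    change G.fiberSum (star (mulComp ψ g x) * y) v = G.fiberSum (star x * mulComp ψ (star g) y) v
    rw [ht _ fun e he => by simp [he, mulComp_apply], ht _ fun e he => by simp [he]]
    refine Finset.sum_congr rfl fun e he => ?_
    simp [mulComp_apply]
    ring

/-- The left action of the graph correspondence `X(G)`: `(a · x)(e) = a(r(e)) x(e)` on `C_c(E)`. -/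
noncomputable def leftAction : C₀(V, ℂ) →⋆ₙₐ[ℂ] Adjointable C₀(V, ℂ) G.X :=
  (G.preAction G.r).extend

end Correspondence

/-- An in-split `(α, W, ψ)` of a topological graph, where `W` is a locally compact Hausdorff space
(by type classes, where it is used). -/
structure InSplit {V E : Type*} [TopologicalSpace V] [TopologicalSpace E]
    (G : TopologicalGraph V E) (W : Type*) [TopologicalSpace W] where
  α : C(W, V)
  ψ : C(E, W)
  isProperMap_α : IsProperMap α
  surjective_α : Function.Surjective α
  /-- `α` restricts to a homeomorphism from the `ψ`-singular points of `W` onto the singular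
  points of `V`. -/
  singular_homeomorph : ∃ h : singularSet ψ ≃ₜ singularSet G.r, ∀ w, (h w : V) = α w
  α_ψ : ∀ e, α (ψ e) = G.r e

namespace InSplit

variable {V E W : Type*} [TopologicalSpace V] [TopologicalSpace E] [TopologicalSpace W]
  {G : TopologicalGraph V E} (I : G.InSplit W)

/-- The edge space `E ×_{s,α} W` of the in-split graph. -/
def Edge : Type _ := {p : E × W // G.s p.1 = I.α p.2}

instance : TopologicalSpace I.Edge := inferInstanceAs (TopologicalSpace (Subtype fun p : E × W => G.s p.1 = I.α p.2))

instance [T2Space E] [T2Space W] : T2Space I.Edge := inferInstanceAs (T2Space (Subtype fun p : E × W => G.s p.1 = I.α p.2))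

instance [T2Space V] [LocallyCompactSpace E] [LocallyCompactSpace W] :
    LocallyCompactSpace I.Edge :=
  (isClosed_eq (G.isLocalHomeomorph_s.continuous.comp continuous_fst)
    (I.α.continuous.comp continuous_snd)).isClosedEmbedding_subtypeVal.locallyCompactSpace

theorem isLocalHomeomorph_snd : IsLocalHomeomorph fun p : I.Edge => p.1.2 := by
  have hcont : Continuous fun p : I.Edge => p.1.2 := continuous_snd.comp continuous_subtype_val
  have hfst : Continuous fun p : I.Edge => p.1.1 := continuous_fst.comp continuous_subtype_val
  have hopen : IsOpenMap fun p : I.Edge => p.1.2 := by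
    rw [isOpenMap_iff_nhds_le]
    intro p S hS
    rw [Filter.mem_map] at hS
    obtain ⟨T, hT, hTS⟩ := mem_nhds_subtype _ _ _ |>.1 hS
    obtain ⟨A, hA, B, hB, hAB⟩ := mem_nhds_prod_iff.1 hT
    have h1 : G.s '' A ∈ nhds (I.α p.1.2) := by
      rw [← p.2]
      exact G.isLocalHomeomorph_s.isOpenMap.image_mem_nhds hA
    filter_upwards [hB, I.α.continuous.continuousAt.preimage_mem_nhds h1] with w hw hw'
    obtain ⟨e, he, hew⟩ := hw'
    exact hTS (show (⟨(e, w), hew⟩ : I.Edge) ∈ Subtype.val ⁻¹' T from hAB ⟨he, hw⟩)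
  rw [isLocalHomeomorph_iff_isOpenEmbedding_restrict]
  intro p
  obtain ⟨U, hU, heU, hi⟩ := G.isLocalHomeomorph_s.isLocallyInjective p.1.1
  have hN : IsOpen {q : I.Edge | q.1.1 ∈ U} := hU.preimage hfst
  refine ⟨_, hN.mem_nhds heU, .of_continuous_injective_isOpenMap
    (hcont.comp continuous_subtype_val) ?_ (hopen.domRestrict hN)⟩
  rintro ⟨q, hq⟩ ⟨q', hq'⟩ h
  have h : q.1.2 = q'.1.2 := h
  refine Subtype.ext (Subtype.ext (Prod.ext (hi hq hq' ?_) h))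
  rw [q.2, q'.2, h]

/-- The in-split graph: `r(e, w) = ψ(e)` and `s(e, w) = w`. -/
def graph : TopologicalGraph W I.Edge where
  r := ⟨fun p => I.ψ p.1.1, I.ψ.continuous.comp (continuous_fst.comp continuous_subtype_val)⟩
  s p := p.1.2
  isLocalHomeomorph_s := I.isLocalHomeomorph_snd

end InSplit

end TopologicalGraph

/-!
For a continuous map `ψ : E → W`, multiplication by `g ∘ ψ` on `X(G)` is compact exactly when
`g ∘ ψ` vanishes at infinity. Evaluation at an edge is a functional of norm one on `X(G)`; along a
compact operator these functionals tend to zero in norm at infinity, since they do so along rank-one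
operators. Conversely, a function supported where `s` is injective acts by a rank-one operator, and
sums of such functions are dense. As `g` annihilates the kernel of the action exactly when it
vanishes on the `ψ`-sources, the covariance ideal of the action consists of the functions vanishing
on the `ψ`-singular points. Both quotients in the definition of an in-split are therefore algebras
of functions on singular sets, which `α` identifies; surjectivity is Tietze extension.

The isomorphism of correspondences is `x ⊗ b ↦ ((e, w) ↦ x(e) b(w))`. It preserves inner products
because the source fibre of `G_I` over `w` is the source fibre of `G` over `α(w)`. Its range is
dense because a function `F` on the edges of `G_I` supported over a set where `s` is injective is
`ξ(e) b(w)`, with `ξ` a cutoff and `b` the sum of `F` over the source fibres.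
-/

section ZeroAtInfty

variable {Y β : Type*} [TopologicalSpace Y] [NormedAddCommGroup β]

theorem norm_zeroAtInfty_apply_le (f : C₀(Y, β)) (y : Y) : ‖f y‖ ≤ ‖f‖ :=
  f.toBCF.norm_coe_le_norm y

theorem norm_zeroAtInfty_le {f : C₀(Y, β)} {C : ℝ} (hC : 0 ≤ C) (h : ∀ y, ‖f y‖ ≤ C) : ‖f‖ ≤ C :=
  (BoundedContinuousFunction.norm_le (f := f.toBCF) hC).2 h

theorem isCompact_setOf_le_norm_zeroAtInfty (f : C₀(Y, β)) {ε : ℝ} (hε : 0 < ε) :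
    IsCompact {y | ε ≤ ‖f y‖} := by
  have h : ∀ᶠ y in Filter.cocompact Y, ‖f y‖ < ε :=
    f.zero_at_infty'.norm.eventually_lt_const (by rwa [norm_zero])
  obtain ⟨K, hK, hKf⟩ := Filter.mem_cocompact.1 h
  refine hK.of_isClosed_subset (isClosed_le (by fun_prop) (by fun_prop)) fun y hy => ?_
  by_contra hyK
  have hlt : ‖f y‖ < ε := hKf hyK
  exact hy.not_gt hlt

end ZeroAtInfty

universe u

/-- Tietze's theorem is applied to the induced map of one-point compactifications. -/
theorem exists_zeroAtInfty_extension {F β : Type*} {Y : Type u} [TopologicalSpace F]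
    [TopologicalSpace Y] [T2Space Y] [LocallyCompactSpace Y] [TopologicalSpace β] [Zero β]
    [TietzeExtension.{u} β] {e : F → Y} (he : Topology.IsClosedEmbedding e) (f : C₀(F, β)) :
    ∃ g : C₀(Y, β), ∀ x, g (e x) = f x := by
  have : T2Space F := he.isEmbedding.t2Space
  have hcont : Continuous (OnePoint.map e) := OnePoint.continuous_map he.continuous <| by
    simpa [Filter.coclosedCompact_eq_cocompact] using he.tendsto_cocompact
  have hinj : Function.Injective (OnePoint.map e) := Option.map_injective he.injective
  obtain ⟨g, hg⟩ := ContinuousMap.exists_extension' (hcont.isClosedEmbedding hinj)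
    (OnePoint.continuousMapMk f.1 0 (by
      rw [Filter.coclosedCompact_eq_cocompact]; exact f.zero_at_infty'))
  have h_infty : g (OnePoint.infty) = 0 := congrFun hg OnePoint.infty
  have hlim := ((OnePoint.continuous_iff g).1 g.continuous).1
  rw [h_infty, Filter.coclosedCompact_eq_cocompact] at hlim
  exact ⟨⟨⟨fun y => g y, g.continuous.comp OnePoint.continuous_coe⟩, hlim⟩, fun x => congrFun hg x⟩

section CompactlySupported

variable {Y : Type*} (𝕜 : Type*) [RCLike 𝕜] [TopologicalSpace Y] [LocallyCompactSpace Y]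

theorem exists_compactlySupported_eq_one [R1Space Y] {K U : Set Y} (hK : IsCompact K)
    (hU : IsOpen U) (hKU : K ⊆ U) :
    ∃ f : C_c(Y, 𝕜), (∀ y ∈ K, f y = 1) ∧ tsupport f ⊆ U ∧ ∀ y, ‖f y‖ ≤ 1 ∧ ‖1 - f y‖ ≤ 1 := by
  obtain ⟨f, hf1, hfc, hfU, hf01⟩ := exists_continuousMap_one_of_isCompact_subset_isOpen hK hU hKU
  have hsupp : tsupport (fun y => (f y : 𝕜)) ⊆ tsupport f :=
    tsupport_comp_subset RCLike.ofReal_zero f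
  refine ⟨⟨⟨fun y => (f y : 𝕜), by fun_prop⟩, hfc.of_isClosed_subset (isClosed_tsupport _) hsupp⟩,
    fun y hy => ?_, hsupp.trans hfU, fun y => ?_⟩
  · exact (congrArg _ (hf1 hy)).trans RCLike.ofReal_one
  · obtain ⟨h0, h1⟩ := hf01 y
    change ‖(f y : 𝕜)‖ ≤ 1 ∧ ‖1 - (f y : 𝕜)‖ ≤ 1
    have hsub : 1 - (f y : 𝕜) = ((1 - f y : ℝ) : 𝕜) := by push_cast; rfl
    rw [hsub, RCLike.norm_ofReal, RCLike.norm_ofReal, abs_of_nonneg h0,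
      abs_of_nonneg (sub_nonneg.2 h1)]
    exact ⟨h1, sub_le_self 1 h0⟩

theorem exists_compactlySupported_norm_sub_mul_comp_le [R1Space Y] {Z : Type*} [TopologicalSpace Z]
    (α : C(Z, Y)) (b : C₀(Z, 𝕜)) {ε : ℝ} (hε : 0 < ε) :
    ∃ a : C_c(Y, 𝕜), ∀ z, ‖b z - a (α z) * b z‖ ≤ ε := by
  obtain ⟨a, ha1, -, ha⟩ := exists_compactlySupported_eq_one 𝕜
    ((isCompact_setOf_le_norm_zeroAtInfty b hε).image α.continuous) isOpen_univ (Set.subset_univ _)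
  refine ⟨a, fun z => ?_⟩
  rw [← one_sub_mul, norm_mul]
  rcases le_total ε ‖b z‖ with hz | hz
  · rw [ha1 _ ⟨z, hz, rfl⟩, sub_self, norm_zero, zero_mul]
    exact hε.le
  · exact (mul_le_of_le_one_left (norm_nonneg _) (ha _).2).trans hz

theorem denseRange_compactlySupported_toZeroAtInfty [R1Space Y] :
    DenseRange ((↑) : C_c(Y, 𝕜) → C₀(Y, 𝕜)) := by
  refine Metric.denseRange_iff.2 fun b ε hε => ?_
  obtain ⟨a, ha⟩ :=
    exists_compactlySupported_norm_sub_mul_comp_le 𝕜 (ContinuousMap.id Y) b (half_pos hε)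
  refine ⟨⟨⟨fun y => a y * b y, by fun_prop⟩, a.hasCompactSupport.mul_right⟩, ?_⟩
  rw [dist_eq_norm]
  exact (norm_zeroAtInfty_le (half_pos hε).le ha).trans_lt (half_lt_self hε)

end CompactlySupported

theorem closure_compactlySupported_tsupport_subset {Y β ι : Type*} [TopologicalSpace Y] [T2Space Y]
    [LocallyCompactSpace Y] [TopologicalSpace β] [AddCommMonoid β] [ContinuousAdd β] [Module ℝ β]
    [ContinuousSMul ℝ β] {U : ι → Set Y} (hU : ∀ i, IsOpen (U i)) (hcov : ⋃ i, U i = Set.univ) :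
    AddSubmonoid.closure {u : C_c(Y, β) | ∃ i, tsupport u ⊆ U i} = ⊤ := by
  refine eq_top_iff.2 fun h _ => ?_
  obtain ⟨t, ht⟩ := h.hasCompactSupport.isCompact.elim_finite_subcover U hU (by simp [hcov])
  let idx : Fin t.card → ι := fun k => t.equivFin.symm k
  have ht' : tsupport h ⊆ ⋃ k, U (idx k) := fun y hy => by
    obtain ⟨i, hi, hy⟩ := Set.mem_iUnion₂.1 (ht hy)
    exact Set.mem_iUnion.2 ⟨t.equivFin ⟨i, hi⟩, by simpa [idx] using hy⟩
  obtain ⟨ρ, hρU, hρ1, -⟩ := exists_continuous_sum_one_of_isOpen_isCompact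
    (fun k => hU (idx k)) h.hasCompactSupport.isCompact ht'
  let u : Fin t.card → C_c(Y, β) := fun k =>
    ⟨⟨fun y => ρ k y • h y, by fun_prop⟩, h.hasCompactSupport.smul_left⟩
  have hsum : h = ∑ k, u k := by
    ext y
    rw [CompactlySupportedContinuousMap.sum_apply]
    change h y = ∑ k, ρ k y • h y
    rw [← Finset.sum_smul]
    by_cases hy : y ∈ tsupport h
    · rw [← Finset.sum_apply, hρ1 hy, Pi.one_apply, one_smul]
    · rw [image_eq_zero_of_notMem_tsupport hy, smul_zero]
  rw [hsum]
  exact sum_mem fun k _ => AddSubmonoid.subset_closure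
    ⟨idx k, (tsupport_smul_subset_left (ρ k) h).trans (hρU k)⟩

section SingularSet

variable {X Y β : Type*} [TopologicalSpace X] [TopologicalSpace Y]

theorem isOpen_finiteReceiverSet (ψ : X → Y) : IsOpen (finiteReceiverSet ψ) := by
  refine isOpen_iff_forall_mem_open.2 ?_
  rintro y ⟨U, hU, hy, hUc, hUψ⟩
  exact ⟨U, fun z hz => ⟨U, hU, hz, hUc, hUψ⟩, hU, hy⟩

theorem singularSet_eq_union (ψ : X → Y) :
    singularSet ψ = (finiteReceiverSet ψ)ᶜ ∪ closure (sourceSet ψ) := by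
  rw [singularSet, regularSet, Set.sdiff_eq, Set.compl_inter, compl_compl]

theorem isClosed_singularSet (ψ : X → Y) : IsClosed (singularSet ψ) := by
  rw [singularSet_eq_union]
  exact (isOpen_finiteReceiverSet ψ).isClosed_compl.union isClosed_closure

theorem isCompact_preimage_of_subset_finiteReceiverSet [T2Space Y] {ψ : X → Y} (hψ : Continuous ψ)
    {K : Set Y} (hK : IsCompact K) (h : K ⊆ finiteReceiverSet ψ) : IsCompact (ψ ⁻¹' K) := by
  choose! U hU hyU _ hUψ using h
  obtain ⟨t, htK, ht⟩ := hK.elim_nhds_subcover U fun y hy => (hU hy).mem_nhds (hyU hy)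
  refine (t.isCompact_biUnion fun y hy => hUψ (htK y hy)).of_isClosed_subset
    (hK.isClosed.preimage hψ) fun x hx => ?_
  obtain ⟨y, hy, hxy⟩ := Set.mem_iUnion₂.1 (ht hx)
  exact Set.mem_iUnion₂.2 ⟨y, hy, subset_closure hxy⟩

variable [NormedAddCommGroup β]

theorem tendsto_comp_cocompact_iff_eq_zero_of_notMem_finiteReceiverSet [T2Space Y] (ψ : C(X, Y))
    (g : C₀(Y, β)) :
    Filter.Tendsto (g ∘ ψ) (Filter.cocompact X) (nhds 0) ↔ ∀ y ∉ finiteReceiverSet ψ, g y = 0 := by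
  constructor
  · intro hlim y hy
    by_contra hne
    have hpos : 0 < ‖g y‖ / 2 := half_pos (norm_pos_iff.2 hne)
    have hclosure : closure {z | ‖g y‖ / 2 < ‖g z‖} ⊆ {z | ‖g y‖ / 2 ≤ ‖g z‖} :=
      closure_lt_subset_le continuous_const (map_continuous g).norm
    let gψ : C₀(X, β) := ⟨⟨g ∘ ψ, by fun_prop⟩, hlim⟩
    exact hy ⟨{z | ‖g y‖ / 2 < ‖g z‖}, isOpen_lt continuous_const (map_continuous g).norm,
      half_lt_self (norm_pos_iff.2 hne),
      (isCompact_setOf_le_norm_zeroAtInfty g hpos).of_isClosed_subset isClosed_closure hclosure,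
      (isCompact_setOf_le_norm_zeroAtInfty gψ hpos).of_isClosed_subset
        (isClosed_closure.preimage ψ.continuous) (Set.preimage_mono hclosure)⟩
  · intro hg
    refine Metric.tendsto_nhds.2 fun ε hε => ?_
    have hK : IsCompact (ψ ⁻¹' {y | ε ≤ ‖g y‖}) := by
      refine isCompact_preimage_of_subset_finiteReceiverSet ψ.continuous
        (isCompact_setOf_le_norm_zeroAtInfty g hε) fun y (hy : ε ≤ ‖g y‖) => ?_
      by_contra hfin
      rw [hg y hfin, norm_zero] at hy
      exact hy.not_gt hε
    filter_upwards [hK.compl_mem_cocompact] with x hx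
    rw [dist_zero_right]
    exact lt_of_not_ge hx

theorem forall_mem_singularSet_eq_zero_iff [T2Space Y] (ψ : C(X, Y)) (g : C₀(Y, β)) :
    (∀ y ∈ singularSet ψ, g y = 0) ↔
      Filter.Tendsto (g ∘ ψ) (Filter.cocompact X) (nhds 0) ∧ ∀ y ∈ sourceSet ψ, g y = 0 := by
  have hzeros : IsClosed {y | g y = 0} := isClosed_eq (map_continuous g) continuous_const
  rw [tendsto_comp_cocompact_iff_eq_zero_of_notMem_finiteReceiverSet, singularSet_eq_union]
  change _ ⊆ {y | g y = 0} ↔ (finiteReceiverSet ψ)ᶜ ⊆ {y | g y = 0} ∧ _ ⊆ {y | g y = 0}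
  rw [Set.union_subset_iff, hzeros.closure_subset_iff]

end SingularSet

namespace HilbertModule

section Operators

variable {A X Y : Type*} [NonUnitalCStarAlgebra A] [NormedAddCommGroup X] [NormedSpace ℂ X]
  [HilbertModule A X] [NormedAddCommGroup Y] [NormedSpace ℂ Y] [HilbertModule A Y]

theorem norm_act_le (x : X) (a : A) : ‖act x a‖ ≤ ‖x‖ * ‖a‖ := by
  refine le_of_sq_le_sq ?_ (by positivity)
  rw [mul_pow, norm_sq (A := A) x, norm_sq (A := A), PreHilbertModule.ip_act,
    PreHilbertModule.act_ip]
  calc ‖star a * toPre.ip x x * a‖ ≤ ‖star a‖ * ‖toPre.ip x x‖ * ‖a‖ := norm_mul₃_le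
    _ = ‖toPre.ip x x‖ * ‖a‖ ^ 2 := by rw [norm_star]; ring

theorem norm_ip_le (x y : X) : ‖ip A x y‖ ≤ ‖x‖ * ‖y‖ := by
  refine le_of_sq_le_sq ?_ (by positivity)
  rw [mul_pow, norm_sq (A := A) x, norm_sq (A := A) y]
  exact PreHilbertModule.norm_ip_sq_le _ x y

theorem continuous_ip : Continuous fun p : X × X => ip A p.1 p.2 := by
  have hbound : ∀ x y : X, ‖ip A x y‖ ≤ 1 * ‖x‖ * ‖y‖ := fun x y => by
    rw [one_mul]
    exact norm_ip_le x y
  exact (((toPre (A := A) (X := X)).ip.mkContinuous₂ 1 hbound).continuous.comp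
    continuous_fst).clm_apply continuous_snd

theorem norm_eq_of_ip_self_eq {x : X} {y : Y} (h : ip A x x = ip A y y) : ‖x‖ = ‖y‖ := by
  rw [← pow_left_inj₀ (norm_nonneg x) (norm_nonneg y) two_ne_zero, norm_sq (A := A) x,
    norm_sq (A := A) y]
  exact congrArg norm h

theorem norm_act_ip_le (x y z : X) : ‖act x (ip A y z)‖ ≤ ‖x‖ * ‖y‖ * ‖z‖ := by
  rw [mul_assoc]
  exact (norm_act_le x _).trans (by gcongr; exact norm_ip_le y z)

/-- The rank-one operator `z ↦ x · (y ∣ z)`, as an element of the adjointable operators; its adjoint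
is the rank-one operator with `x` and `y` exchanged. -/
noncomputable def rankOne (x y : X) : Adjointable A X :=
  ⟨(toPre.act x ∘ₗ toPre.ip (A := A) y).mkContinuous _ (norm_act_ip_le x y),
    (toPre.act y ∘ₗ toPre.ip (A := A) x).mkContinuous _ (norm_act_ip_le y x), fun z w => by
      change toPre.ip (toPre.act x (toPre.ip y z)) w = toPre.ip z (toPre.act y (toPre.ip x w))
      rw [PreHilbertModule.act_ip, PreHilbertModule.ip_act, PreHilbertModule.star_ip]⟩

theorem rankOne_apply (x y z : X) : (rankOne (A := A) x y).1 z = act x (ip A y z) := rfl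

theorem rankOne_mem_compacts (x y : X) : rankOne x y ∈ Adjointable.compacts A X :=
  Submodule.le_topologicalClosure _ (Submodule.subset_span ⟨x, y, rankOne_apply x y⟩)

theorem map_act_of_map_ip {β : X → Y} (hβ : Function.Surjective β)
    (h : ∀ x y, ip A (β x) (β y) = ip A x y) (x : X) (a : A) : β (act x a) = act (β x) a := by
  refine ext_ip A fun z => ?_
  obtain ⟨y, rfl⟩ := hβ z
  simp only [ip] at h ⊢
  rw [h, PreHilbertModule.ip_act, PreHilbertModule.ip_act, h]

theorem ip_linearCombination_eq {ι : Type*} {f : ι → X} {g : ι → Y}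
    (h : ∀ i j, ip A (f i) (f j) = ip A (g i) (g j)) (c d : ι →₀ ℂ) :
    ip A (Finsupp.linearCombination ℂ f c) (Finsupp.linearCombination ℂ f d) =
      ip A (Finsupp.linearCombination ℂ g c) (Finsupp.linearCombination ℂ g d) := by
  simp only [ip] at h ⊢
  simp only [Finsupp.linearCombination_apply, Finsupp.sum, map_sum, LinearMap.sum_apply,
    map_smulₛₗ, LinearMap.smul_apply, h]

theorem exists_linearIsometryEquiv_of_ip_eq {ι : Type*} {f : ι → X} {g : ι → Y}
    (hf : Dense (Submodule.span ℂ (Set.range f) : Set X))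
    (hg : Dense (Submodule.span ℂ (Set.range g) : Set Y))
    (h : ∀ i j, ip A (f i) (f j) = ip A (g i) (g j)) :
    ∃ U : X ≃ₗᵢ[ℂ] Y, (∀ i, U (f i) = g i) ∧ ∀ x y, ip A (U x) (U y) = ip A x y := by
  have : CompleteSpace X := complete (A := A)
  have : CompleteSpace Y := complete (A := A)
  have hdense : DenseRange (Finsupp.linearCombination ℂ f) := by
    rwa [DenseRange, ← LinearMap.coe_range, Finsupp.range_linearCombination]
  have hnorm : ∃ C, ∀ c,
      ‖Finsupp.linearCombination ℂ g c‖ ≤ C * ‖Finsupp.linearCombination ℂ f c‖ :=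
    ⟨1, fun c => by
      rw [one_mul, norm_eq_of_ip_self_eq (A := A) (ip_linearCombination_eq h c c)]⟩
  let U : X →L[ℂ] Y :=
    (Finsupp.linearCombination ℂ g).extendOfNorm (Finsupp.linearCombination ℂ f)
  have hU : ∀ c, U (Finsupp.linearCombination ℂ f c) = Finsupp.linearCombination ℂ g c :=
    LinearMap.extendOfNorm_eq hdense hnorm
  have hUf : ∀ i, U (f i) = g i := fun i => by
    simpa only [Finsupp.linearCombination_single, one_smul] using hU (Finsupp.single i 1)
  have hip : ∀ x y, ip A (U x) (U y) = ip A x y := by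
    refine hdense.induction_on₂ (isClosed_eq ?_ continuous_ip) fun c d => ?_
    · exact continuous_ip.comp (U.continuous.prodMap U.continuous)
    · rw [hU, hU, ip_linearCombination_eq h]
  let V : X →ₗᵢ[ℂ] Y := ⟨U, fun x => norm_eq_of_ip_self_eq (hip x x)⟩
  have hV : Function.Surjective V := by
    have hclosed : IsClosed (LinearMap.range V.toLinearMap : Set Y) :=
      V.isometry.isClosedEmbedding.isClosed_range
    have hle : Submodule.span ℂ (Set.range g) ≤ LinearMap.range V.toLinearMap :=
      Submodule.span_le.2 (Set.range_subset_iff.2 fun i => ⟨f i, hUf i⟩)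
    exact Set.range_eq_univ.1
      (hclosed.closure_eq.symm.trans (hg.mono (SetLike.coe_subset_coe.2 hle)).closure_eq)
  exact ⟨.ofSurjective V hV, hUf, hip⟩

end Operators

section Tensor

variable {A B X : Type*} [NonUnitalCStarAlgebra A] [NonUnitalCStarAlgebra B]
  [NormedAddCommGroup X] [NormedSpace ℂ X] [HilbertModule A X] (α : A →⋆ₙₐ[ℂ] B)

theorem ip_tmul (x y : X) (b c : B) :
    ip B (tmul α x b) (tmul α y c) = star b * α (ip A x y) * c :=
  ((tensorPre X α).ipCompletion_ι _ _).trans (tensorIp_tmul X α x y b c)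

theorem norm_tmul_le (x : X) (b : B) : ‖tmul α x b‖ ≤ ‖b‖ * ‖x‖ := by
  refine le_of_sq_le_sq ?_ (by positivity)
  rw [norm_sq (A := B), mul_pow, norm_sq (A := A) x]
  calc ‖ip B (tmul α x b) (tmul α x b)‖ = ‖star b * α (ip A x x) * b‖ := by rw [ip_tmul]
    _ ≤ ‖star b‖ * ‖α (ip A x x)‖ * ‖b‖ := norm_mul₃_le
    _ ≤ ‖star b‖ * ‖ip A x x‖ * ‖b‖ := by
        gcongr
        exact NonUnitalStarAlgHom.norm_apply_le α _
    _ = ‖b‖ ^ 2 * ‖ip A x x‖ := by rw [norm_star]; ring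

theorem continuous_tmul_left (b : B) : Continuous fun x : X => tmul α x b :=
  (((tensorPre X α).ι ∘ₗ (TensorProduct.mk ℂ X B).flip b).mkContinuous ‖b‖
    fun x => norm_tmul_le α x b).continuous

theorem dense_span_tmul {ι : Type*} {f : ι → X} (hf : DenseRange f) :
    Dense (Submodule.span ℂ (Set.range fun p : ι × B => tmul α (f p.1) p.2) :
      Set (Tensor X α)) := by
  set S := Submodule.span ℂ (Set.range fun p : ι × B => tmul α (f p.1) p.2)
  have htmul : ∀ (x : X) (b : B), tmul α x b ∈ S.topologicalClosure := fun x b =>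
    hf.induction_on x (S.isClosed_topologicalClosure.preimage (continuous_tmul_left α b))
      fun i => S.le_topologicalClosure (Submodule.subset_span ⟨(i, b), rfl⟩)
  have hι : ∀ z, (tensorPre X α).ι z ∈ S.topologicalClosure := fun z => by
    induction z with
    | zero => rw [map_zero]; exact zero_mem _
    | tmul x b => exact htmul x b
    | add z w hz hw => rw [map_add]; exact add_mem hz hw
  exact fun z => (tensorPre X α).induction_ι S.isClosed_topologicalClosure hι z

end Tensor

end HilbertModule

theorem forall_mem_sourceSet_eq_zero_iff {X Y 𝕜 : Type*} [RCLike 𝕜] [TopologicalSpace X]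
    [TopologicalSpace Y] [R1Space Y] [LocallyCompactSpace Y] (ψ : X → Y) (g : C₀(Y, 𝕜)) :
    (∀ y ∈ sourceSet ψ, g y = 0) ↔ ∀ c : C₀(Y, 𝕜), (∀ x, c (ψ x) = 0) → g * c = 0 := by
  constructor
  · intro hg c hc
    ext y
    rw [ZeroAtInftyContinuousMap.mul_apply, ZeroAtInftyContinuousMap.zero_apply, mul_eq_zero]
    refine or_iff_not_imp_left.2 fun hgy => ?_
    have hy : y ∈ closure (Set.range ψ) := by
      by_contra hy
      exact hgy (hg y hy)
    exact closure_minimal (Set.range_subset_iff.2 hc)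
      (isClosed_eq (map_continuous c) continuous_const) hy
  · intro hg y hy
    obtain ⟨c, hc1, hcsupp, -⟩ := exists_compactlySupported_eq_one 𝕜 isCompact_singleton
      isClosed_closure.isOpen_compl (Set.singleton_subset_iff.2 hy)
    have hcψ : ∀ x, c (ψ x) = 0 := fun x => by
      by_contra hne
      exact hcsupp (subset_tsupport c hne) (subset_closure ⟨x, rfl⟩)
    have hgc : g y * c y = 0 := DFunLike.congr_fun (hg (c : C₀(Y, 𝕜)) hcψ) y
    rwa [hc1 y rfl, mul_one] at hgc

namespace TopologicalGraph

section Evaluation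

variable {V E : Type*} [TopologicalSpace V] [TopologicalSpace E] [T2Space V] [T2Space E]
  [LocallyCompactSpace E] (G : TopologicalGraph V E)

theorem act_toX (x : C_c(E, ℂ)) (a : C₀(V, ℂ)) :
    act (G.toX x) a = G.toX (mulComp ⟨G.s, G.isLocalHomeomorph_s.continuous⟩ a x) :=
  G.preModule.actCompletion_ι a x

theorem ip_toX (x y : C_c(E, ℂ)) :
    ip C₀(V, ℂ) (G.toX x) (G.toX y) = G.fiberSum (star x * y) :=
  G.preModule.ipCompletion_ι x y

theorem denseRange_toX : DenseRange G.toX :=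
  G.preModule.denseRange_ι

@[elab_as_elim]
theorem induction_toX {p : G.X → Prop} (x : G.X) (hp : IsClosed {x | p x})
    (h : ∀ x, p (G.toX x)) : p x :=
  G.preModule.induction_ι hp h x

theorem fiberSum_apply_source {S : Set E} (hS : Set.InjOn G.s S) {f : C_c(E, ℂ)}
    (hf : Function.support f ⊆ S) {e : E} (he : e ∈ S) : G.fiberSum f (G.s e) = f e := by
  rw [G.fiberSum_eq_sum f _ (t := {e}) (by simp), Finset.sum_singleton]
  intro e' hs hne
  exact Finset.mem_singleton.2 (hS (hf hne) he hs)

theorem norm_toX_le {x : C_c(E, ℂ)} (hx : Set.InjOn G.s (Function.support x)) {C : ℝ}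
    (hC : 0 ≤ C) (h : ∀ e, ‖x e‖ ≤ C) : ‖G.toX x‖ ≤ C := by
  refine le_of_sq_le_sq ?_ hC
  rw [norm_sq (A := C₀(V, ℂ)) (G.toX x)]
  change ‖ip C₀(V, ℂ) (G.toX x) (G.toX x)‖ ≤ C ^ 2
  rw [ip_toX]
  refine norm_zeroAtInfty_le (sq_nonneg C) fun v => ?_
  by_cases hv : ∃ e, G.s e = v ∧ x e ≠ 0
  · obtain ⟨e, rfl, he⟩ := hv
    rw [G.fiberSum_apply_source hx (Function.support_mul_subset_right _ _) he,
      CompactlySupportedContinuousMap.mul_apply, CompactlySupportedContinuousMap.star_apply,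
      norm_mul, norm_star, ← sq]
    exact pow_le_pow_left₀ (norm_nonneg _) (h e) 2
  · push Not at hv
    have hzero : G.fiberSum (star x * x) v = 0 :=
      finsum_mem_eq_zero_of_forall_eq_zero fun e he => mul_eq_zero_of_right _ (hv e he)
    rw [hzero, norm_zero]
    exact sq_nonneg C

theorem exists_apply_eq_one_norm_toX_le_one (e : E) :
    ∃ ξ : C_c(E, ℂ), ξ e = 1 ∧ Set.InjOn G.s (Function.support ξ) ∧ ‖G.toX ξ‖ ≤ 1 := by
  obtain ⟨U, hU, heU, hinj⟩ := G.isLocalHomeomorph_s.isLocallyInjective e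
  obtain ⟨ξ, hξ1, hξU, hξ⟩ := exists_compactlySupported_eq_one ℂ (isCompact_singleton (x := e)) hU
    (Set.singleton_subset_iff.2 heU)
  have hξinj : Set.InjOn G.s (Function.support ξ) := hinj.mono ((subset_tsupport ξ).trans hξU)
  exact ⟨ξ, hξ1 e rfl, hξinj, G.norm_toX_le hξinj zero_le_one fun y => (hξ y).1⟩

/-- Evaluation at `e` is the inner product with a cutoff around `e`. -/
theorem norm_apply_le_norm_toX (x : C_c(E, ℂ)) (e : E) : ‖x e‖ ≤ ‖G.toX x‖ := by
  obtain ⟨ξ, hξe, hξinj, hξ⟩ := G.exists_apply_eq_one_norm_toX_le_one e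
  have he : e ∈ Function.support ξ := by simp [hξe]
  have hsupp : Function.support (star ξ * x) ⊆ Function.support ξ :=
    fun e' he' h0 => he' (by simp [h0])
  have heval : x e = ip C₀(V, ℂ) (G.toX ξ) (G.toX x) (G.s e) := by
    rw [ip_toX, G.fiberSum_apply_source hξinj hsupp he]
    simp [hξe]
  calc ‖x e‖ ≤ ‖ip C₀(V, ℂ) (G.toX ξ) (G.toX x)‖ := heval ▸ norm_zeroAtInfty_apply_le _ _
    _ ≤ ‖G.toX ξ‖ * ‖G.toX x‖ := norm_ip_le _ _
    _ ≤ ‖G.toX x‖ := mul_le_of_le_one_left (norm_nonneg _) hξ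

/-- Evaluation at an edge, extended from `C_c(E)` to `X(G)`. -/
noncomputable def evalCLM (e : E) : G.X →L[ℂ] ℂ :=
  LinearMap.extendOfNorm
    ({ toFun := fun x => x e, map_add' := fun _ _ => rfl, map_smul' := fun _ _ => rfl } :
      C_c(E, ℂ) →ₗ[ℂ] ℂ) G.toX

theorem evalCLM_toX (e : E) (x : C_c(E, ℂ)) : G.evalCLM e (G.toX x) = x e :=
  LinearMap.extendOfNorm_eq G.denseRange_toX
    ⟨1, fun x => (G.norm_apply_le_norm_toX x e).trans_eq (one_mul _).symm⟩ x

theorem norm_evalCLM (e : E) : ‖G.evalCLM e‖ = 1 := by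
  refine le_antisymm (LinearMap.opNorm_extendOfNorm_le G.denseRange_toX zero_le_one fun x =>
    (G.norm_apply_le_norm_toX x e).trans_eq (one_mul _).symm) ?_
  obtain ⟨ξ, hξe, -, hξ⟩ := G.exists_apply_eq_one_norm_toX_le_one e
  calc (1 : ℝ) = ‖G.evalCLM e (G.toX ξ)‖ := by rw [evalCLM_toX, hξe, norm_one]
    _ ≤ ‖G.evalCLM e‖ := (G.evalCLM e).unit_le_opNorm _ hξ

theorem evalCLM_act (e : E) (x : G.X) (a : C₀(V, ℂ)) :
    G.evalCLM e (act x a) = a (G.s e) * G.evalCLM e x := by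
  induction x using G.induction_toX with
  | hp =>
    exact isClosed_eq ((G.evalCLM e).continuous.comp (G.preModule.actCompletion a).continuous)
      (by fun_prop)
  | h x =>
    rw [act_toX, evalCLM_toX, evalCLM_toX]
    rfl

theorem tendsto_evalCLM_cocompact (x : G.X) :
    Filter.Tendsto (fun e => G.evalCLM e x) (Filter.cocompact E) (nhds 0) := by
  induction x using G.induction_toX with
  | hp =>
    exact (LipschitzWith.uniformEquicontinuous (fun e x => G.evalCLM e x) 1 fun e =>
      (G.evalCLM e).lipschitzWith_of_opNorm_le (G.norm_evalCLM e).le).equicontinuous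
        |>.isClosed_setOfPred_tendsto continuous_const
  | h x =>
    simp only [evalCLM_toX]
    exact x.hasCompactSupport.is_zero_at_infty

theorem norm_evalCLM_comp_rankOne_le (e : E) (x y : G.X) :
    ‖G.evalCLM e ∘L (rankOne (A := C₀(V, ℂ)) x y).1‖ ≤ ‖y‖ * ‖G.evalCLM e x‖ := by
  refine ContinuousLinearMap.opNorm_le_bound _ (by positivity) fun z => ?_
  rw [ContinuousLinearMap.comp_apply, rankOne_apply, evalCLM_act, norm_mul]
  calc ‖ip C₀(V, ℂ) y z (G.s e)‖ * ‖G.evalCLM e x‖ ≤ (‖y‖ * ‖z‖) * ‖G.evalCLM e x‖ := by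
        gcongr
        exact (norm_zeroAtInfty_apply_le _ _).trans (norm_ip_le y z)
    _ = ‖y‖ * ‖G.evalCLM e x‖ * ‖z‖ := by ring

theorem tendsto_evalCLM_comp_cocompact_of_mem_compacts {T : Adjointable C₀(V, ℂ) G.X}
    (hT : T ∈ Adjointable.compacts C₀(V, ℂ) G.X) :
    Filter.Tendsto (fun e => G.evalCLM e ∘L T.1) (Filter.cocompact E) (nhds 0) := by
  have hlip : ∀ e, LipschitzWith 1 fun T : Adjointable C₀(V, ℂ) G.X => G.evalCLM e ∘L T.1 :=
    fun e => LipschitzWith.mk_one fun S T => by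
      rw [dist_eq_norm, dist_eq_norm, ← ContinuousLinearMap.comp_sub]
      refine (ContinuousLinearMap.opNorm_comp_le _ _).trans ?_
      rw [norm_evalCLM, one_mul]
      rfl
  refine closure_minimal (t := {T : Adjointable C₀(V, ℂ) G.X | Filter.Tendsto
    (fun e => G.evalCLM e ∘L T.1) (Filter.cocompact E) (nhds 0)}) (fun S hS => ?_)
    ((LipschitzWith.uniformEquicontinuous _ 1 hlip).equicontinuous.isClosed_setOfPred_tendsto
      continuous_const) hT
  induction hS using Submodule.span_induction with
  | mem S hS =>
    obtain ⟨x, y, hxy⟩ := hS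
    obtain rfl : S = rankOne x y := Subtype.ext (ContinuousLinearMap.ext hxy)
    refine squeeze_zero_norm (fun e => G.norm_evalCLM_comp_rankOne_le e x y) ?_
    simpa using (G.tendsto_evalCLM_cocompact x).norm.const_mul ‖y‖
  | zero => simpa using tendsto_const_nhds
  | add S T _ _ hS hT => simpa using hS.add hT
  | smul c S _ hS =>
    rw [← smul_zero c]
    exact (hS.const_smul c).congr fun e => ((G.evalCLM e).comp_smul c S.1).symm

end Evaluation

section CompAction

variable {V E W : Type*} [TopologicalSpace V] [TopologicalSpace E] [TopologicalSpace W]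
  [T2Space V] [T2Space E] [LocallyCompactSpace E] (G : TopologicalGraph V E) (ψ : C(E, W))

/-- The left action of `C₀(W)` on `X(G)` by multiplication with `g ∘ ψ`; the left action of the
graph correspondence is the case `ψ = r`. -/
noncomputable def compAction : C₀(W, ℂ) →⋆ₙₐ[ℂ] Adjointable C₀(V, ℂ) G.X :=
  (G.preAction ψ).extend

theorem compAction_toX (g : C₀(W, ℂ)) (x : C_c(E, ℂ)) :
    (G.compAction ψ g).1 (G.toX x) = G.toX (mulComp ψ g x) :=
  (G.preAction ψ).extend_ι g x

theorem adjointable_ext_toX {S T : Adjointable C₀(V, ℂ) G.X}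
    (h : ∀ x, S.1 (G.toX x) = T.1 (G.toX x)) : S = T :=
  Subtype.ext (DFunLike.coe_injective
    (G.denseRange_toX.equalizer S.1.continuous T.1.continuous (funext h)))

theorem norm_compAction_le (g : C₀(W, ℂ)) : ‖G.compAction ψ g‖ ≤ ‖g‖ := by
  refine ContinuousLinearMap.opNorm_le_bound _ (norm_nonneg g) fun x => ?_
  induction x using G.induction_toX with
  | hp => exact isClosed_le (G.compAction ψ g).1.continuous.norm (by fun_prop)
  | h x => exact (congrArg norm (G.compAction_toX ψ g x)).trans_le ((G.preAction ψ).norm_le g x)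

theorem continuous_compAction : Continuous (G.compAction ψ) :=
  AddMonoidHomClass.continuous_of_bound (G.compAction ψ) 1 fun g => by
    rw [one_mul]
    exact G.norm_compAction_le ψ g

theorem evalCLM_comp_compAction (e : E) (g : C₀(W, ℂ)) :
    G.evalCLM e ∘L (G.compAction ψ g).1 = g (ψ e) • G.evalCLM e := by
  refine DFunLike.coe_injective (G.denseRange_toX.equalizer (ContinuousLinearMap.continuous _)
    (ContinuousLinearMap.continuous _) (funext fun x => ?_))
  simp only [Function.comp_apply, ContinuousLinearMap.comp_apply, compAction_toX, evalCLM_toX,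
    smul_apply, mulComp_apply, smul_eq_mul]

theorem norm_evalCLM_comp_compAction (e : E) (g : C₀(W, ℂ)) :
    ‖G.evalCLM e ∘L (G.compAction ψ g).1‖ = ‖g (ψ e)‖ := by
  rw [evalCLM_comp_compAction, norm_smul, norm_evalCLM, mul_one]

theorem compAction_eq_zero_iff (g : C₀(W, ℂ)) : G.compAction ψ g = 0 ↔ ∀ e, g (ψ e) = 0 := by
  constructor
  · intro h e
    rw [← norm_eq_zero, ← G.norm_evalCLM_comp_compAction ψ e, h]
    exact (congrArg norm (G.evalCLM e).comp_zero).trans norm_zero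
  · intro h
    refine G.adjointable_ext_toX fun x => ?_
    have hx : mulComp ψ g x = 0 := by
      ext e
      rw [mulComp_apply, h, zero_mul, CompactlySupportedContinuousMap.zero_apply]
    rw [compAction_toX, hx, map_zero]
    rfl

theorem compAction_id_eq_rankOne {U : Set E} (hU : Set.InjOn G.s U) {u ξ : C_c(E, ℂ)}
    (hu : Function.support u ⊆ U) (hξ : Function.support ξ ⊆ U) (huξ : ∀ e, u e ≠ 0 → ξ e = 1) :
    G.compAction (.id E) (u : C₀(E, ℂ)) = rankOne (G.toX u) (G.toX ξ) := by
  refine G.adjointable_ext_toX fun z => ?_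
  rw [compAction_toX, rankOne_apply, ip_toX, act_toX]
  congr 1
  ext e
  change u e * z e = G.fiberSum (star ξ * z) (G.s e) * u e
  rcases eq_or_ne (u e) 0 with hue | hue
  · rw [hue, zero_mul, mul_zero]
  · have hsupp : Function.support (star ξ * z) ⊆ U := fun e' he' =>
      hξ fun h0 => he' (by simp [h0])
    rw [G.fiberSum_apply_source hU hsupp (hu hue), mul_comm]
    simp [huξ e hue]

theorem compAction_id_mem_compacts (f : C₀(E, ℂ)) :
    G.compAction (.id E) f ∈ Adjointable.compacts C₀(V, ℂ) G.X := by
  refine (denseRange_compactlySupported_toZeroAtInfty ℂ).induction_on f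
    ((Submodule.isClosed_topologicalClosure _).preimage (G.continuous_compAction _)) fun u => ?_
  choose U hU heU hinj using G.isLocalHomeomorph_s.isLocallyInjective
  have hu : u ∈ AddSubmonoid.closure {u : C_c(E, ℂ) | ∃ e, tsupport u ⊆ U e} := by
    rw [closure_compactlySupported_tsupport_subset hU
      (Set.iUnion_eq_univ_iff.2 fun e => ⟨e, heU e⟩)]
    trivial
  induction hu using AddSubmonoid.closure_induction with
  | mem u hu =>
    obtain ⟨e, hu⟩ := hu
    obtain ⟨ξ, hξ1, hξU, -⟩ :=
      exists_compactlySupported_eq_one ℂ u.hasCompactSupport.isCompact (hU e) hu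
    rw [G.compAction_id_eq_rankOne (hinj e) ((subset_tsupport u).trans hu)
      ((subset_tsupport ξ).trans hξU) fun y hy => hξ1 y (subset_tsupport u hy)]
    exact rankOne_mem_compacts _ _
  | zero => exact (map_zero (G.compAction (.id E))).symm ▸ zero_mem _
  | add u v _ _ hu hv => exact
    (map_add (G.compAction (.id E)) (u : C₀(E, ℂ)) (v : C₀(E, ℂ))).symm ▸ add_mem hu hv

theorem compAction_mem_compacts_iff (g : C₀(W, ℂ)) :
    G.compAction ψ g ∈ Adjointable.compacts C₀(V, ℂ) G.X ↔
      Filter.Tendsto (g ∘ ψ) (Filter.cocompact E) (nhds 0) := by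
  constructor
  · intro hg
    refine squeeze_zero_norm
      (fun e => (G.norm_evalCLM_comp_compAction ψ e g).ge) ?_
    simpa using (G.tendsto_evalCLM_comp_cocompact_of_mem_compacts hg).norm
  · intro hg
    let gψ : C₀(E, ℂ) := ⟨⟨g ∘ ψ, by fun_prop⟩, hg⟩
    have heq : G.compAction ψ g = G.compAction (.id E) gψ := G.adjointable_ext_toX fun x => by
      rw [compAction_toX, compAction_toX]
      rfl
    exact heq ▸ G.compAction_id_mem_compacts gψ

theorem mem_covarianceIdeal_compAction_iff [T2Space W] [LocallyCompactSpace W] (g : C₀(W, ℂ)) :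
    g ∈ covarianceIdeal (G.compAction ψ) ↔ ∀ w ∈ singularSet ψ, g w = 0 := by
  rw [forall_mem_singularSet_eq_zero_iff ψ g, forall_mem_sourceSet_eq_zero_iff,
    ← G.compAction_mem_compacts_iff ψ g]
  simp only [← G.compAction_eq_zero_iff ψ]
  rfl

end CompAction

theorem isNondegenerateAction_leftAction {V E : Type*} [TopologicalSpace V] [TopologicalSpace E]
    [T2Space V] [T2Space E] [LocallyCompactSpace V] [LocallyCompactSpace E]
    (G : TopologicalGraph V E) : IsNondegenerateAction G.leftAction := by
  refine Submodule.dense_iff_topologicalClosure_eq_top.1 (G.denseRange_toX.mono ?_)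
  rintro _ ⟨x, rfl⟩
  obtain ⟨b, hb, -⟩ := exists_compactlySupported_eq_one ℂ
    (x.hasCompactSupport.isCompact.image G.r.continuous) isOpen_univ (Set.subset_univ _)
  have hbx : mulComp G.r (b : C₀(V, ℂ)) x = x := by
    ext e
    rw [mulComp_apply]
    by_cases he : x e = 0
    · rw [he, mul_zero]
    · exact (congrArg (· * x e) (hb _ ⟨e, subset_tsupport _ he, rfl⟩)).trans (one_mul _)
  exact Submodule.subset_span
    ⟨b, G.toX x, (congrArg G.toX hbx).symm.trans (G.compAction_toX G.r b x).symm⟩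

namespace InSplit

variable {V E W : Type*} [TopologicalSpace V] [TopologicalSpace E] [TopologicalSpace W]
  {G : TopologicalGraph V E} (I : G.InSplit W)

/-- The `*`-homomorphism `f ↦ f ∘ α` from `C₀(V)` to `C₀(W)`, written `α*` in the theorem. -/
noncomputable def pullback : C₀(V, ℂ) →⋆ₙₐ[ℂ] C₀(W, ℂ) where
  toFun f := ⟨f.1.comp I.α, f.zero_at_infty'.comp <|
    (Filter.hasBasis_cocompact.tendsto_iff Filter.hasBasis_cocompact).2 fun _ hK =>
      ⟨_, I.isProperMap_α.isCompact_preimage hK, fun _ hw => hw⟩⟩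
  map_smul' _ _ := rfl
  map_zero' := rfl
  map_add' _ _ := rfl
  map_mul' _ _ := rfl
  map_star' _ := rfl

theorem pullback_apply (f : C₀(V, ℂ)) (w : W) : I.pullback f w = f (I.α w) := rfl

theorem pullback_injective : Function.Injective I.pullback := fun f g h => by
  ext v
  obtain ⟨w, rfl⟩ := I.surjective_α v
  exact DFunLike.congr_fun h w

theorem isNondegenerateHom_pullback [T2Space V] [LocallyCompactSpace V] :
    IsNondegenerateHom I.pullback := by
  refine Submodule.dense_iff_topologicalClosure_eq_top.1 (Metric.dense_iff.2 fun b ε hε => ?_)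
  obtain ⟨a, ha⟩ := exists_compactlySupported_norm_sub_mul_comp_le ℂ I.α b (half_pos hε)
  refine ⟨I.pullback (a : C₀(V, ℂ)) * b, ?_, Submodule.subset_span ⟨a, b, rfl⟩⟩
  rw [Metric.mem_ball, dist_comm, dist_eq_norm]
  exact (norm_zeroAtInfty_le (half_pos hε).le ha).trans_lt (half_lt_self hε)

theorem exists_pullback_eqOn_singularSet [T2Space V] [LocallyCompactSpace V] (g : C₀(W, ℂ)) :
    ∃ f, ∀ w ∈ singularSet I.ψ, I.pullback f w = g w := by
  obtain ⟨h, hh⟩ := I.singular_homeomorph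
  let g' : C₀(singularSet G.r, ℂ) :=
    ⟨g.1.comp ⟨fun v => ((h.symm v : singularSet I.ψ) : W), by fun_prop⟩,
      g.zero_at_infty'.comp ((isClosed_singularSet I.ψ).isClosedEmbedding_subtypeVal.comp
        h.symm.isClosedEmbedding).tendsto_cocompact⟩
  obtain ⟨f, hf⟩ :=
    exists_zeroAtInfty_extension (isClosed_singularSet G.r).isClosedEmbedding_subtypeVal g'
  refine ⟨f, fun w hw => ?_⟩
  calc
    f (I.α w) = f (h ⟨w, hw⟩) := congrArg f (hh ⟨w, hw⟩).symm
    _ = g (h.symm (h ⟨w, hw⟩) : singularSet I.ψ) := hf _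
    _ = g w := by rw [h.symm_apply_apply]

section Action

variable [T2Space V] [T2Space E] [LocallyCompactSpace E]

theorem compAction_comp_pullback : (G.compAction I.ψ).comp I.pullback = G.leftAction := by
  ext f : 1
  refine G.adjointable_ext_toX fun x => ?_
  refine (G.compAction_toX I.ψ (I.pullback f) x).trans
    (Eq.trans ?_ (G.compAction_toX G.r f x).symm)
  congr 1
  ext e
  rw [mulComp_apply, mulComp_apply, pullback_apply, I.α_ψ]

variable [LocallyCompactSpace V] [T2Space W] [LocallyCompactSpace W]

theorem comap_pullback_covarianceIdeal :
    (covarianceIdeal (G.compAction I.ψ)).comap (LinearMapClass.linearMap I.pullback) =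
      covarianceIdeal G.leftAction := by
  obtain ⟨h, hh⟩ := I.singular_homeomorph
  ext f
  calc
    I.pullback f ∈ covarianceIdeal (G.compAction I.ψ) ↔
        ∀ w : singularSet I.ψ, f (I.α w) = 0 := by
      rw [mem_covarianceIdeal_compAction_iff, Subtype.forall]
      rfl
    _ ↔ ∀ v : singularSet G.r, f v = 0 := by simp only [h.surjective.forall, hh]
    _ ↔ f ∈ covarianceIdeal G.leftAction :=
      Subtype.forall.trans (G.mem_covarianceIdeal_compAction_iff G.r f).symm

theorem isInSplit : IsInSplit G.leftAction I.pullback (G.compAction I.ψ) where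
  nondegenerate := G.isNondegenerateAction_leftAction
  hom_nondegenerate := I.isNondegenerateHom_pullback
  hom_injective := I.pullback_injective
  comp_eq := I.compAction_comp_pullback
  map_ideal := I.comap_pullback_covarianceIdeal.ge
  quotient_bijective := by
    constructor
    · rw [← LinearMap.ker_eq_bot, Submodule.ker_mapQ, I.comap_pullback_covarianceIdeal,
        Submodule.mkQ_map_self]
    · intro g
      obtain ⟨g, rfl⟩ := Submodule.Quotient.mk_surjective _ g
      obtain ⟨f, hf⟩ := I.exists_pullback_eqOn_singularSet g
      refine ⟨Submodule.Quotient.mk f, ?_⟩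
      rw [Submodule.mapQ_apply, Submodule.Quotient.eq, mem_covarianceIdeal_compAction_iff]
      exact fun w hw => sub_eq_zero.2 (hf w hw)

end Action

theorem finsum_mem_fiber {M : Type*} [AddCommMonoid M] (f : E → M) (w : W) :
    ∑ᶠ p ∈ I.graph.s ⁻¹' {w}, f p.1.1 = ∑ᶠ e ∈ G.s ⁻¹' {I.α w}, f e := by
  refine finsum_mem_eq_of_bijOn (fun p => p.1.1) ⟨fun p hp => ?_, fun p hp q hq h => ?_,
    fun e he => ⟨⟨(e, w), he⟩, rfl, rfl⟩⟩ fun _ _ => rfl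
  · exact p.2.trans (congrArg I.α hp)
  · exact Subtype.ext (Prod.ext h (Eq.trans hp hq.symm))

theorem injOn_source_preimage {U : Set E} (hU : Set.InjOn G.s U) :
    Set.InjOn I.graph.s {p | p.1.1 ∈ U} := fun p hp q hq h =>
  Subtype.ext (Prod.ext (hU hp hq (p.2.trans ((congrArg I.α h).trans q.2.symm))) h)

section EdgeProd

variable [T2Space V]

theorem isClosedEmbedding_val : Topology.IsClosedEmbedding (Subtype.val : I.Edge → E × W) :=
  (isClosed_eq (G.isLocalHomeomorph_s.continuous.comp continuous_fst)
    (I.α.continuous.comp continuous_snd)).isClosedEmbedding_subtypeVal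

/-- The function `(e, w) ↦ x(e) b(w)` on the edge space of the in-split graph. It is the image of
the elementary tensor `x ⊗ b` under the isomorphism `X(G) ⊗ C₀(W) ≅ X(G_I)`. -/
noncomputable def edgeProd (x : C_c(E, ℂ)) (b : C₀(W, ℂ)) : C_c(I.Edge, ℂ) where
  toFun p := x p.1.1 * b p.1.2
  continuous_toFun :=
    ((map_continuous x).comp (continuous_fst.comp continuous_subtype_val)).mul
      ((map_continuous b).comp (continuous_snd.comp continuous_subtype_val))
  hasCompactSupport' := by
    have hs : IsCompact (G.s '' tsupport x) :=
      x.hasCompactSupport.isCompact.image G.isLocalHomeomorph_s.continuous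
    have hcompact : IsCompact (tsupport x ×ˢ (I.α ⁻¹' (G.s '' tsupport x))) :=
      x.hasCompactSupport.isCompact.prod (I.isProperMap_α.isCompact_preimage hs)
    have hclosed : IsClosed (tsupport x ×ˢ (I.α ⁻¹' (G.s '' tsupport x))) :=
      (isClosed_tsupport x).prod (hs.isClosed.preimage I.α.continuous)
    refine HasCompactSupport.intro' (I.isClosedEmbedding_val.isCompact_preimage hcompact)
      (hclosed.preimage continuous_subtype_val) fun p hp => by_contra fun hne => hp ?_
    have hpx : p.1.1 ∈ tsupport x := subset_tsupport x (left_ne_zero_of_mul hne)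
    exact ⟨hpx, p.1.1, hpx, p.2⟩

theorem edgeProd_apply (x : C_c(E, ℂ)) (b : C₀(W, ℂ)) (p : I.Edge) :
    I.edgeProd x b p = x p.1.1 * b p.1.2 := rfl

theorem edgeProd_mulComp (g : C₀(W, ℂ)) (x : C_c(E, ℂ)) (b : C₀(W, ℂ)) :
    I.edgeProd (mulComp I.ψ g x) b = mulComp I.graph.r g (I.edgeProd x b) := by
  ext p
  rw [mulComp_apply, edgeProd_apply, edgeProd_apply, mulComp_apply, mul_assoc]
  rfl

variable [T2Space E] [T2Space W] [LocallyCompactSpace E] [LocallyCompactSpace W]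

theorem fiberSum_edgeProd (x y : C_c(E, ℂ)) (b c : C₀(W, ℂ)) :
    I.graph.fiberSum (star (I.edgeProd x b) * I.edgeProd y c) =
      star b * I.pullback (G.fiberSum (star x * y)) * c := by
  ext w
  calc
    ∑ᶠ p ∈ I.graph.s ⁻¹' {w}, star (x p.1.1 * b p.1.2) * (y p.1.1 * c p.1.2)
    _ = ∑ᶠ p ∈ I.graph.s ⁻¹' {w}, star (b w) * c w * (star (x p.1.1) * y p.1.1) := by
      refine finsum_mem_congr rfl fun p hp => ?_
      rw [show p.1.2 = w from hp, star_mul']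
      ring
    _ = star (b w) * c w * ∑ᶠ e ∈ G.s ⁻¹' {I.α w}, star (x e) * y e := by
      rw [← mul_finsum_mem, I.finsum_mem_fiber fun e => star (x e) * y e]
    _ = star (b w) * (∑ᶠ e ∈ G.s ⁻¹' {I.α w}, star (x e) * y e) * c w := mul_right_comm _ _ _

theorem exists_eq_edgeProd {U : Set E} (hU : IsOpen U) (hUs : Set.InjOn G.s U) {F : C_c(I.Edge, ℂ)}
    (hF : ∀ p ∈ tsupport F, p.1.1 ∈ U) : ∃ x b, F = I.edgeProd x b := by
  have hfst : Continuous fun p : I.Edge => p.1.1 := continuous_fst.comp continuous_subtype_val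
  obtain ⟨ξ, hξ, hξU, -⟩ := exists_compactlySupported_eq_one ℂ
    (F.hasCompactSupport.isCompact.image hfst) hU (Set.image_subset_iff.2 hF)
  refine ⟨ξ, I.graph.fiberSum F, ?_⟩
  ext p
  rw [edgeProd_apply]
  by_cases hp : p.1.1 ∈ U
  · have hsum : I.graph.fiberSum F p.1.2 = F p := I.graph.fiberSum_apply_source
      (I.injOn_source_preimage hUs) (fun q hq => hF q (subset_tsupport F hq)) hp
    rw [hsum]
    by_cases hFp : F p = 0
    · rw [hFp, mul_zero]
    · rw [hξ _ ⟨p, subset_tsupport F hFp, rfl⟩, one_mul]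
  · rw [image_eq_zero_of_notMem_tsupport fun h => hp (hF p h),
      image_eq_zero_of_notMem_tsupport fun h => hp (hξU h), zero_mul]

theorem dense_span_edgeProd :
    Dense (Submodule.span ℂ (Set.range fun p : C_c(E, ℂ) × C₀(W, ℂ) =>
      I.graph.toX (I.edgeProd p.1 p.2)) : Set I.graph.X) := by
  refine I.graph.denseRange_toX.mono ?_
  rintro _ ⟨F, rfl⟩
  choose U hU heU hinj using G.isLocalHomeomorph_s.isLocallyInjective
  have hU' : ∀ e, IsOpen {p : I.Edge | p.1.1 ∈ U e} := fun e =>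
    (hU e).preimage (continuous_fst.comp continuous_subtype_val)
  have hF : F ∈ AddSubmonoid.closure
      {F : C_c(I.Edge, ℂ) | ∃ e, tsupport F ⊆ {p : I.Edge | p.1.1 ∈ U e}} := by
    rw [closure_compactlySupported_tsupport_subset hU'
      (Set.iUnion_eq_univ_iff.2 fun p => ⟨p.1.1, heU p.1.1⟩)]
    trivial
  induction hF using AddSubmonoid.closure_induction with
  | mem F hF =>
    obtain ⟨e, hF⟩ := hF
    obtain ⟨x, b, rfl⟩ := I.exists_eq_edgeProd (hU e) (hinj e) hF
    exact Submodule.subset_span ⟨(x, b), rfl⟩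
  | zero => exact (map_zero I.graph.toX).symm ▸ zero_mem _
  | add F F' _ _ hF hF' => exact (map_add I.graph.toX F F').symm ▸ add_mem hF hF'

theorem exists_tensor_isomorphism :
    ∃ β : Tensor G.X I.pullback →ₗ[ℂ] I.graph.X, Function.Bijective β ∧
      IsCorrespondenceMorphism (tensorAction I.pullback (G.compAction I.ψ)) I.graph.leftAction
        (NonUnitalStarAlgHom.id ℂ C₀(W, ℂ)) β := by
  have hdense := dense_span_tmul I.pullback (B := C₀(W, ℂ)) G.denseRange_toX
  obtain ⟨β, hβ, hip⟩ := exists_linearIsometryEquiv_of_ip_eq (A := C₀(W, ℂ)) hdense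
    I.dense_span_edgeProd fun p q => by
      rw [ip_tmul, ip_toX, ip_toX, fiberSum_edgeProd]
  refine ⟨β.toLinearEquiv, β.bijective, hip, map_act_of_map_ip β.surjective hip, fun g z => ?_⟩
  have hleft : (β : Tensor G.X I.pullback →L[ℂ] I.graph.X) ∘L
      (tensorAction I.pullback (G.compAction I.ψ) g).1 =
      (I.graph.compAction I.graph.r g).1 ∘L (β : Tensor G.X I.pullback →L[ℂ] I.graph.X) := by
    refine ContinuousLinearMap.ext_on hdense ?_
    rintro _ ⟨⟨x, b⟩, rfl⟩
    change β ((tensorAction I.pullback (G.compAction I.ψ) g).1 (tmul I.pullback (G.toX x) b)) =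
      (I.graph.compAction I.graph.r g).1 (β (tmul I.pullback (G.toX x) b))
    rw [tensorAction_tmul, compAction_toX, hβ (_, b), hβ (x, b), compAction_toX, edgeProd_mulComp]
  exact DFunLike.congr_fun hleft z

end EdgeProd

end InSplit

end TopologicalGraph

theorem mainTheorem6_general {V E W : Type*}
    [TopologicalSpace V] [T2Space V] [LocallyCompactSpace V]
    [TopologicalSpace E] [T2Space E] [LocallyCompactSpace E]
    [TopologicalSpace W] [T2Space W] [LocallyCompactSpace W]
    (G : TopologicalGraph V E) (I : G.InSplit W) :
    ∃ (αs : C₀(V, ℂ) →⋆ₙₐ[ℂ] C₀(W, ℂ))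
      (ψs : C₀(W, ℂ) →⋆ₙₐ[ℂ] HilbertModule.Adjointable C₀(V, ℂ) G.X),
      (∀ f w, αs f w = f (I.α w)) ∧
      (∀ (f : C₀(W, ℂ)) (x y : C_c(E, ℂ)), (∀ e, y e = f (I.ψ e) * x e) →
        (ψs f).1 (G.toX x) = G.toX y) ∧
      IsInSplit G.leftAction αs ψs ∧
      ∃ β : HilbertModule.Tensor G.X αs →ₗ[ℂ] I.graph.X,
        Function.Bijective β ∧
        IsCorrespondenceMorphism (HilbertModule.tensorAction αs ψs) I.graph.leftAction
          (NonUnitalStarAlgHom.id ℂ C₀(W, ℂ)) β := by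
  refine ⟨I.pullback, G.compAction I.ψ, fun _ _ => rfl, fun f x y h => ?_, I.isInSplit,
    I.exists_tensor_isomorphism⟩
  rw [TopologicalGraph.compAction_toX]
  congr 1
  ext e
  exact (h e).symm

theorem mainTheorem6 {V E W : Type*}
    [TopologicalSpace V] [T2Space V] [LocallyCompactSpace V] [SecondCountableTopology V]
    [TopologicalSpace E] [T2Space E] [LocallyCompactSpace E] [SecondCountableTopology E]
    [TopologicalSpace W] [T2Space W] [LocallyCompactSpace W]
    (G : TopologicalGraph V E) (I : G.InSplit W) :
    ∃ (αs : C₀(V, ℂ) →⋆ₙₐ[ℂ] C₀(W, ℂ))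
      (ψs : C₀(W, ℂ) →⋆ₙₐ[ℂ] HilbertModule.Adjointable C₀(V, ℂ) G.X),
      (∀ f w, αs f w = f (I.α w)) ∧
      (∀ (f : C₀(W, ℂ)) (x y : C_c(E, ℂ)), (∀ e, y e = f (I.ψ e) * x e) →
        (ψs f).1 (G.toX x) = G.toX y) ∧
      IsInSplit G.leftAction αs ψs ∧
      ∃ β : HilbertModule.Tensor G.X αs →ₗ[ℂ] I.graph.X,
        Function.Bijective β ∧
        IsCorrespondenceMorphism (HilbertModule.tensorAction αs ψs) I.graph.leftAction
          (NonUnitalStarAlgHom.id ℂ C₀(W, ℂ)) β :=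
  mainTheorem6_general G I
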